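/- Let $\mathcal A=\mathbb C[[\hbar]]$, let $P$ be the flip of $\mathbb C^2\otimes\mathbb C^2$ and $R(u)=\frac{1}{u+\hbar}(u+\hbar P)$ Yang's $R$-matrix. Let $\mathcal D Y_\hbar(\mathfrak{gl}_2)$ be the ($\hbar$-adically complete and separated) topological $\mathcal A$-algebra with generators $t_{ij}^k$ ($1\le i,j\le 2$, $k\in\mathbb Z$) and $c$, subject to the following relations for the matrices $T^{\pm}(u)=(t^{\pm}_{ij}(u))$, where $$t^+_{ij}(u)=\delta_{ij}-\hbar\sum_{k\ge 0}t^k_{ij}u^{-k-1},\qquad t^-_{ij}(u)=\delta_{ij}+\hbar\sum_{k<0}t^k_{ij}u^{-k-1},$$ and $u_\pm=u\pm\frac14\hbar c$, $v_\pm=v\pm\frac14\hbar c$: $$[T^\pm(u),c]=0,\qquad R(u-v)\,T_1^\pm(u)T_2^\pm(v)=T_2^\pm(v)T_1^\pm(u)\,R(u-v),$$ $$R(u_--v_+)\,T_1^+(u)T_2^-(v)=T_2^-(v)T_1^+(u)\,R(u_+-v_-).$$ Put $$X^+(u)=t_{11}^+(u_-)^{-1}t_{12}^+(u_-)-t_{11}^-(u_+)^{-1}t_{12}^-(u_+),\qquad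 X^-(u)=t_{21}^+(u_+)t_{11}^+(u_+)^{-1}-t_{21}^-(u_-)t_{11}^-(u_-)^{-1},$$ $$k_1^\pm(u)=t_{11}^\pm(u),\qquad k_2^\pm(u)=t_{22}^\pm(u)-t_{21}^\pm(u)t_{11}^\pm(u)^{-1}t_{12}^\pm(u),\qquad \delta(u-v)=\sum_{k\in\mathbb Z}u^{-k-1}v^k .$$ Then the power series $k_1^\pm(u),k_2^\pm(u)$ are invertible, and for all $i,j\in\{1,2\}$ the following relations hold coefficientwise. In each relation with double signs one takes either all upper or all lower signs; the rational factors multiplying an expression in $k^+_i(u)$ are expanded in $|u|>|v|$, those multiplying an expression in $k_i^-(u)$ in $|v|>|u|$; and all infinite sums converge $\hbar$-adically. $$k_i^\pm(u)k_j^\pm(v)=k_j^\pm(v)k_i^\pm(u),\qquad k_i^+(u)k_i^-(v)=k_i^-(v)k_i^+(u),$$ $$\frac{u_\mp-v_\pm}{u_\mp-v_\pm+\hbar}\,k_2^\mp(v)^{-1}k_1^\pm(u)=\frac{u_\pm-v_\mp}{u_\pm-v_\mp+\hbar}\,k_1^\pm(u)k_2^\mp(v)^{-1},$$ $$k_1^\pm(u)^{-1}X^+(v)k_1^\pm(u)=\frac{u_\pm-v+\hbar}{u_\pm-v}X^+(v),\qquad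 k_1^\pm(u)X^-(v)k_1^\pm(u)^{-1}=\frac{u_\mp-v+\hbar}{u_\mp-v}X^-(v),$$ $$k_2^\pm(u)^{-1}X^+(v)k_2^\pm(u)=\frac{u_\pm-v-\hbar}{u_\pm-v}X^+(v),\qquad k_2^\pm(u)X^-(v)k_2^\pm(u)^{-1}=\frac{u_\mp-v-\hbar}{u_\mp-v}X^-(v),$$ $$(u-v\mp\hbar)X^\pm(u)X^\pm(v)=(u-v\pm\hbar)X^\pm(v)X^\pm(u),$$ $$[X^+(u),X^-(v)]=\hbar\left\{\delta(u_--v_+)\,k_2^+(u_-)k_1^+(u_-)^{-1}-\delta(u_+-v_-)\,k_2^-(v_-)k_1^-(v_-)^{-1}\right\}.$$ The same holds if $\mathcal D Y_\hbar(\mathfrak{gl}_2)$ is understood as presented by these generators and relations among $\hbar$-torsion-free complete algebras. -/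

import Mathlib

open scoped PowerSeries

noncomputable section

namespace YangianDouble

/-! ## Signs, one- and two-variable series -/

/-- The sign in `T^±`, `k_i^±`, `X^±`, `u_±`. -/
inductive Sgn where
  | pos : Sgn
  | neg : Sgn

/-- The opposite sign. -/
def Sgn.flip : Sgn → Sgn
  | .pos => .neg
  | .neg => .pos

/-- The sign as an integer. -/
def Sgn.val : Sgn → ℤ
  | .pos => 1
  | .neg => -1

/-- `f : Dist A` stands for the two-sided formal series `f(u) = ∑_{a ∈ ℤ} f a * u^a`. -/
abbrev Dist (A : Type*) := ℤ → A

/-- `f : BiDist A` stands for `f(u,v) = ∑_{a,b ∈ ℤ} f a b * u^a * v^b`. -/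
abbrev BiDist (A : Type*) := ℤ → ℤ → A

section Series

variable {A : Type*} [Ring A]

/-- A power series `p` read as a formal series in `u`: for the sign `+` its variable is `u⁻¹`,
for the sign `-` its variable is `u`. -/
def ser : Sgn → A⟦X⟧ → Dist A
  | .pos, p => fun a => if a ≤ 0 then PowerSeries.coeff (-a).toNat p else 0
  | .neg, p => fun a => if 0 ≤ a then PowerSeries.coeff a.toNat p else 0

/-- `(u - v + s) * f(u,v)`. -/
def lin (s : A) (f : BiDist A) : BiDist A :=
  fun a b => f (a - 1) b - f a (b - 1) + s * f a b

/-- `f(u) g(v)`. -/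
def outer (f g : Dist A) : BiDist A := fun a b => f a * g b

/-- `g(v) f(u)`. -/
def outerRev (f g : Dist A) : BiDist A := fun a b => g b * f a

/-- `f(u)` as a series in `u, v`. -/
def inU (f : Dist A) : BiDist A := fun a b => if b = 0 then f a else 0

/-- `f(v)` as a series in `u, v`. -/
def inV (f : Dist A) : BiDist A := fun a b => if a = 0 then f b else 0

/-- The expansion of `1/(u - v)`: for the sign `+` in the domain `|u| > |v|`, where it is
`∑_{k ≥ 0} u^(-k-1) v^k`, and for the sign `-` in the domain `|v| > |u|`, where it is
`-∑_{k ≥ 0} u^k v^(-k-1)`. -/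
def cauchy : Sgn → BiDist A
  | .pos => fun a b => if a + b = -1 ∧ 0 ≤ b then 1 else 0
  | .neg => fun a b => if a + b = -1 ∧ 0 ≤ a then -1 else 0

/-- `δ(u - v) = ∑_{k ∈ ℤ} u^(-k-1) v^k`. -/
def delta : BiDist A := fun a b => if a + b = -1 then 1 else 0

end Series

/-! ## The algebra -/

/-- The generators `t_{ij}^k` (`1 ≤ i, j ≤ 2`, `k ∈ ℤ`) and `c`. -/
inductive Gen where
  | t (i j : Fin 2) (k : ℤ) : Gen
  | c : Gen

/-- The `ħ`-adically complete `ℂ[[ħ]]`-algebra freely generated by the `t_{ij}^k` and `c`, realised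
as the power series in the central variable `ħ` over the free complex algebra. -/
abbrev FreeDY : Type := (FreeAlgebra ℂ Gen)⟦X⟧

namespace FreeDY

/-- The formal parameter `ħ`. -/
def h : FreeDY := PowerSeries.X

/-- The generator `c`. -/
def c : FreeDY := PowerSeries.C (FreeAlgebra.ι ℂ Gen.c)

/-- The generator `t_{ij}^k`. -/
def t (i j : Fin 2) (k : ℤ) : FreeDY := PowerSeries.C (FreeAlgebra.ι ℂ (Gen.t i j k))

/-- `t_{ij}^+(u) = δ_{ij} - ħ ∑_{k ≥ 0} t_{ij}^k u^(-k-1)`, a power series in `u⁻¹`, and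
`t_{ij}^-(u) = δ_{ij} + ħ ∑_{k < 0} t_{ij}^k u^(-k-1)`, a power series in `u`. -/
def T : Sgn → Fin 2 → Fin 2 → FreeDY⟦X⟧
  | .pos, i, j => PowerSeries.mk fun n => match n with
      | 0 => if i = j then 1 else 0
      | m + 1 => -(h * t i j m)
  | .neg, i, j => PowerSeries.mk fun m =>
      (if m = 0 ∧ i = j then 1 else 0) + h * t i j (-(m : ℤ) - 1)

/-- Elements of `End(V ⊗ V)` with coefficients formal series in `u, v`, as matrices: the entry at
`(i,k), (j,l)` is the coefficient of `E_{ij} ⊗ E_{kl}`. -/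
abbrev Mat4 := Matrix (Fin 2 × Fin 2) (Fin 2 × Fin 2) (BiDist FreeDY)

/-- `T^σ(u)` in the first tensor factor times `T^τ(v)` in the second one. -/
def TT (σ τ : Sgn) : Mat4 := fun x y =>
  outer (ser σ (T σ x.1 y.1)) (ser τ (T τ x.2 y.2))

/-- `T^τ(v)` in the second tensor factor times `T^σ(u)` in the first one. -/
def TTrev (σ τ : Sgn) : Mat4 := fun x y =>
  outerRev (ser σ (T σ x.1 y.1)) (ser τ (T τ x.2 y.2))

/-- Multiplication by `x + ħ P` from the left, where `x = u - v + s` and `P` is the flip. -/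
def yangL (s : FreeDY) (M : Mat4) : Mat4 := fun x y a b =>
  lin s (M x y) a b + h * M x.swap y a b

/-- Multiplication by `x + ħ P` from the right, where `x = u - v + s` and `P` is the flip. -/
def yangR (s : FreeDY) (M : Mat4) : Mat4 := fun x y a b =>
  lin s (M x y) a b + h * M x y.swap a b

/-- Multiplication by the scalar `u - v + s`. -/
def linMat (s : FreeDY) (M : Mat4) : Mat4 := fun x y => lin s (M x y)

/-- `ħ c / 2`, so that `u_∓ - v_± = u - v ∓ ħ c / 2`. -/
def hc2 : FreeDY := h * ((1 / 2 : ℂ) • c)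

/-- The defining relations (as differences of the coefficients of the two sides), for
`R(x) = (x + ħ P) / (x + ħ)`:

* `T^σ(u) c = c T^σ(u)`;
* `R(u-v) T₁^σ(u) T₂^σ(v) = T₂^σ(v) T₁^σ(u) R(u-v)`, where the scalar `1 / (u - v + ħ)`, common to
  the two sides, is dropped;
* `R(u_- - v_+) T₁^+(u) T₂^-(v) = T₂^-(v) T₁^+(u) R(u_+ - v_-)`, multiplied by
  `(u_- - v_+ + ħ) (u_+ - v_- + ħ)`. Both sides of it are series in `u⁻¹` and `v`, on which the
  factors `u - v + s` act invertibly (with inverses expanded in `|u| > |v|`), so that nothing is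
  lost or gained. -/
inductive Rel : FreeDY → Prop
  | central (σ : Sgn) (i j : Fin 2) (n : ℕ) :
      Rel (PowerSeries.coeff n (T σ i j) * c - c * PowerSeries.coeff n (T σ i j))
  | same (σ : Sgn) (x y : Fin 2 × Fin 2) (a b : ℤ) :
      Rel (yangL 0 (TT σ σ) x y a b - yangR 0 (TTrev σ σ) x y a b)
  | mixed (x y : Fin 2 × Fin 2) (a b : ℤ) :
      Rel (linMat (hc2 + h) (yangL (-hc2) (TT .pos .neg)) x y a b
        - linMat (-hc2 + h) (yangR hc2 (TTrev .pos .neg)) x y a b)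

end FreeDY

/-- A two-sided ideal that is closed in the `ħ`-adic topology. -/
def IsClosedIdeal (J : TwoSidedIdeal FreeDY) : Prop :=
  ∀ x : FreeDY, (∀ N : ℕ, ∃ y : FreeDY, x - FreeDY.h ^ N * y ∈ J) → x ∈ J

/-- A two-sided ideal whose quotient has no `ħ`-torsion. -/
def IsSaturatedIdeal (J : TwoSidedIdeal FreeDY) : Prop :=
  ∀ x : FreeDY, FreeDY.h * x ∈ J → x ∈ J

/-- The closed two-sided ideal generated by the defining relations. -/
def relIdeal : TwoSidedIdeal FreeDY :=
  sInf {J | (∀ x, FreeDY.Rel x → x ∈ J) ∧ IsClosedIdeal J}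

/-- The smallest closed two-sided ideal that contains the defining relations and whose quotient is
a torsion-free (hence topologically free) `ℂ[[ħ]]`-module. -/
def relIdealTF : TwoSidedIdeal FreeDY :=
  sInf {J | (∀ x, FreeDY.Rel x → x ∈ J) ∧ IsClosedIdeal J ∧ IsSaturatedIdeal J}

/-- The quotient of the free `ħ`-adically complete algebra by `J`. For `J = relIdeal` this is the
topological algebra `DY_ħ(gl_2)` presented by the generators and relations above; for
`J = relIdealTF` it is the same algebra in the category of torsion-free complete algebras. -/
abbrev DY (J : TwoSidedIdeal FreeDY) : Type := J.ringCon.Quotient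

section Algebra

variable (J : TwoSidedIdeal FreeDY)

/-- The projection onto `DY J`. -/
def proj : FreeDY →+* DY J := J.ringCon.mk'

/-- The formal parameter `ħ` in `DY J`. -/
def hbar : DY J := proj J FreeDY.h

/-- `c / 4`, so that `u_± = u ± ħ (c / 4)`. -/
def c4 : DY J := proj J ((1 / 4 : ℂ) • FreeDY.c)

/-- `t_{ij}^±(u)` in `DY J`. -/
def T (σ : Sgn) (i j : Fin 2) : (DY J)⟦X⟧ := PowerSeries.map (proj J) (FreeDY.T σ i j)

/-! ### Sums that converge `ħ`-adically -/

/-- The family `f` is `ħ`-adically summable with sum `s` (the net of the finite partial sums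
converges to `s` in the `ħ`-adic topology). -/
def IsHSum {ι : Type*} (f : ι → DY J) (s : DY J) : Prop :=
  ∀ N : ℕ, ∃ S : Finset ι, ∀ S' : Finset ι, S ⊆ S' →
    ∃ y : DY J, s - ∑ i ∈ S', f i = hbar J ^ N * y

theorem exists_hsum (x : ℕ → DY J) :
    ∃ s : DY J, ∀ N : ℕ, ∃ y : DY J,
      s - ∑ n ∈ Finset.range N, hbar J ^ n * x n = hbar J ^ N * y := by
  have hsurj : Function.Surjective (proj J) := J.ringCon.mk'_surjective
  choose g hg using fun n => hsurj (x n)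
  let F : ℕ → FreeDY := fun N => PowerSeries.mk fun m =>
    ∑ n ∈ Finset.range (m + 1), PowerSeries.coeff (m - n) (g (N + n))
  have step : ∀ N, F N = g N + FreeDY.h * F (N + 1) := by
    intro N
    ext m
    rcases m with _ | m
    · simp [F, FreeDY.h]
    · simp only [F, FreeDY.h, map_add, PowerSeries.coeff_mk, PowerSeries.coeff_succ_X_mul]
      rw [Finset.sum_range_succ']
      simp only [Nat.add_sub_add_right, Nat.sub_zero, Nat.add_zero]
      rw [add_comm]
      congr 1
      refine Finset.sum_congr rfl fun n _ => ?_
      rw [show N + (n + 1) = N + 1 + n by omega]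
  refine ⟨proj J (F 0), fun N => ⟨proj J (F N), ?_⟩⟩
  induction N with
  | zero => simp
  | succ N ih =>
    rw [Finset.sum_range_succ, ← sub_sub, ih, step N, map_add, map_mul, hg]
    change hbar J ^ N * (x N + hbar J * _) - _ = _
    rw [mul_add, pow_succ, mul_assoc]
    abel

/-- The sum `∑_{n ≥ 0} ħ^n x_n`. -/
def hsum (x : ℕ → DY J) : DY J := (exists_hsum J x).choose

/-- `f(u + ħ s) = ∑_m f_m ∑_{n ≥ 0} binom(m, n) (ħ s)^n u^(m-n)` for `f(u) = ∑_m f_m u^m`. -/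
def shift (s : DY J) (f : Dist (DY J)) : Dist (DY J) :=
  fun a => hsum J fun n => Ring.choose (a + (n : ℤ)) n • (s ^ n * f (a + n))

/-- `g(u + ħ s, v)`. -/
def shiftU (s : DY J) (g : BiDist (DY J)) : BiDist (DY J) :=
  fun a b => shift J s (fun a' => g a' b) a

/-- `g(u, v + ħ s)`. -/
def shiftV (s : DY J) (g : BiDist (DY J)) : BiDist (DY J) :=
  fun a b => shift J s (g a) b

/-- The expansion of `(U - V + r ħ) / (U - V + s ħ)`, where `U = u + ħ x` and `V = v + ħ y`, as a
power series in `ħ` with coefficients expanded in `|u| > |v|` for the sign `+` and in `|v| > |u|`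
for the sign `-`. -/
def frac (σ : Sgn) (x y : DY J) (r s : ℤ) : BiDist (DY J) :=
  lin (hbar J * (x - y + (r : DY J)))
    (shiftU J (x + (s : DY J)) (shiftV J y (cauchy σ)))

/-- `δ(U - V)`, where `U = u + ħ x` and `V = v + ħ y`. -/
def deltaShift (x y : DY J) : BiDist (DY J) := shiftU J x (shiftV J y delta)

/-- The product `r(u,v) g(u,v)` exists (all of its coefficients converge) and equals `w(u,v)`. -/
def IsProd (r g w : BiDist (DY J)) : Prop :=
  ∀ a b : ℤ, IsHSum J (fun p : ℤ × ℤ => r p.1 p.2 * g (a - p.1) (b - p.2)) (w a b)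

/-! ### The currents -/

/-- `t_{11}^±(u)⁻¹ t_{12}^±(u)`. -/
def e (σ : Sgn) : (DY J)⟦X⟧ := Ring.inverse (T J σ 0 0) * T J σ 0 1

/-- `t_{21}^±(u) t_{11}^±(u)⁻¹`. -/
def f (σ : Sgn) : (DY J)⟦X⟧ := T J σ 1 0 * Ring.inverse (T J σ 0 0)

/-- `k_1^±(u)`, a power series in `u^{∓1}`. -/
def k1 (σ : Sgn) : (DY J)⟦X⟧ := T J σ 0 0

/-- `k_2^±(u)`, a power series in `u^{∓1}`. -/
def k2 (σ : Sgn) : (DY J)⟦X⟧ :=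
  T J σ 1 1 - T J σ 1 0 * Ring.inverse (T J σ 0 0) * T J σ 0 1

/-- `k_1^±(u)` and `k_2^±(u)`, indexed by `0` and `1`. -/
def k (i : Fin 2) (σ : Sgn) : (DY J)⟦X⟧ := if i = 0 then k1 J σ else k2 J σ

/-- `k_2^±(u) k_1^±(u)⁻¹`. -/
def k2k1inv (σ : Sgn) : (DY J)⟦X⟧ := k2 J σ * Ring.inverse (k1 J σ)

/-- `± c / 4`, so that `u_σ = u + ħ (pm σ)`. -/
def pm (σ : Sgn) : DY J := (σ.val : DY J) * c4 J

/-- `X^+(u) = t_{11}^+(u_-)⁻¹ t_{12}^+(u_-) - t_{11}^-(u_+)⁻¹ t_{12}^-(u_+)` and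
`X^-(u) = t_{21}^+(u_+) t_{11}^+(u_+)⁻¹ - t_{21}^-(u_-) t_{11}^-(u_-)⁻¹`. -/
def Xcur : Sgn → Dist (DY J)
  | .pos => shift J (pm J .neg) (ser .pos (e J .pos)) - shift J (pm J .pos) (ser .neg (e J .neg))
  | .neg => shift J (pm J .pos) (ser .pos (f J .pos)) - shift J (pm J .neg) (ser .neg (f J .neg))

/-- `p(u) X(v) q(u)`, where `p(u)` and `q(u)` are power series in `u^{∓1}`. -/
def sandwich (σ : Sgn) (p : (DY J)⟦X⟧) (X : Dist (DY J)) (q : (DY J)⟦X⟧) : BiDist (DY J) :=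
  fun a b => ser σ (p * PowerSeries.C (X b) * q) a

end Algebra

end YangianDouble

end

open YangianDouble

namespace YangianDouble

section Gauss

variable {K B : Type*} [CommRing K] [Ring B] [Algebra K B]

/-- The entries of `(y + h) (x + h P) T₁ S₂ = (x + h) S₂ T₁ (y + h P)`. -/
def RTT (x y h : K) (T S : Matrix (Fin 2) (Fin 2) B) : Prop :=
  ∀ i j k l, (y + h) • (x • (T i j * S k l) + h • (T k j * S i l)) =
    (x + h) • (y • (S k l * T i j) + h • (S k j * T i l))

/-- The Gauss coordinates of a `2 × 2` matrix whose entry `a` is invertible. -/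
structure IsGauss (T : Matrix (Fin 2) (Fin 2) B) (a d e f : B) : Prop where
  t00 : T 0 0 = a
  t01 : T 0 1 = a * e
  t10 : T 1 0 = f * a
  t11 : T 1 1 = d + f * a * e
  unit_a : IsUnit a

/-- The scalars which are cancelled act injectively. -/
structure Reg (B : Type*) [Ring B] [Algebra K B] (x y h : K) : Prop where
  rx : IsSMulRegular B x
  ry : IsSMulRegular B y
  xp : IsSMulRegular B (x + h)
  yp : IsSMulRegular B (y + h)
  xm : IsSMulRegular B (x - h)
  ym : IsSMulRegular B (y - h)

theorem isSMulRegular_neg {x : K} (hx : IsSMulRegular B x) : IsSMulRegular B (-x) := by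
  intro a b hab
  simp only [neg_smul, neg_inj] at hab
  exact hx hab

theorem Reg.neg {x y h : K} (r : Reg B x y h) : Reg B (-x) (-y) h where
  rx := isSMulRegular_neg r.rx
  ry := isSMulRegular_neg r.ry
  xp := by simpa [neg_sub, sub_eq_neg_add] using isSMulRegular_neg r.xm
  yp := by simpa [neg_sub, sub_eq_neg_add] using isSMulRegular_neg r.ym
  xm := by simpa [neg_add, sub_eq_add_neg, add_comm] using isSMulRegular_neg r.xp
  ym := by simpa [neg_add, sub_eq_add_neg, add_comm] using isSMulRegular_neg r.yp

theorem Reg.symm {x y h : K} (r : Reg B x y h) : Reg B y x h :=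
  ⟨r.ry, r.rx, r.yp, r.xp, r.ym, r.xm⟩

theorem RTT.diag_comm {x y h : K} {T S : Matrix (Fin 2) (Fin 2) B} (H : RTT x y h T S)
    (r : Reg B x y h) (i j : Fin 2) : T i j * S i j = S i j * T i j := by
  apply r.yp
  apply r.xp
  simp only
  linear_combination (norm := module) H i j i j

variable {x y h : K} {T S : Matrix (Fin 2) (Fin 2) B} {a d e f a' d' e' f' : B}

theorem RTT.a_comm (H : RTT x y h T S) (r : Reg B x y h) (HT : IsGauss T a d e f)
    (HS : IsGauss S a' d' e' f') : a * a' = a' * a := by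
  simpa only [HT.t00, HS.t00] using H.diag_comm r 0 0

theorem RTT.a_e (H : RTT x y h T S) (r : Reg B x y h) (HT : IsGauss T a d e f)
    (HS : IsGauss S a' d' e' f') : (y + h) • (a * e') = y • (e' * a) + h • (a * e) := by
  have hc := H.a_comm r HT HS
  have h1 := H 0 0 0 1
  simp only [HT.t00, HS.t00, HT.t01, HS.t01] at h1
  rw [← mul_assoc a a' e', hc] at h1
  apply HS.unit_a.mul_left_cancel
  apply r.xp
  simp only [mul_add, mul_smul_comm, mul_assoc] at h1 ⊢
  linear_combination (norm := module) h1

theorem RTT.a_f (H : RTT x y h T S) (r : Reg B x y h) (HT : IsGauss T a d e f)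
    (HS : IsGauss S a' d' e' f') : x • (a * f') = (x + h) • (f' * a) - h • (f * a) := by
  have hc := H.a_comm r HT HS
  have h1 := H 0 0 1 0
  simp only [HT.t00, HS.t00, HT.t10, HS.t10] at h1
  apply HS.unit_a.mul_right_cancel
  apply r.yp
  simp only [sub_mul, smul_mul_assoc, mul_assoc, hc] at h1 ⊢
  linear_combination (norm := module) h1

/-- `T ⊗ 1`. -/
def ampL (T : Matrix (Fin 2) (Fin 2) B) : Matrix (Fin 2 × Fin 2) (Fin 2 × Fin 2) B :=
  Matrix.of fun p q => if p.2 = q.2 then T p.1 q.1 else 0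

/-- `1 ⊗ S`. -/
def ampR (S : Matrix (Fin 2) (Fin 2) B) : Matrix (Fin 2 × Fin 2) (Fin 2 × Fin 2) B :=
  Matrix.of fun p q => if p.1 = q.1 then S p.2 q.2 else 0

/-- The flip of the two tensor factors. -/
def flipM (B : Type*) [Ring B] : Matrix (Fin 2 × Fin 2) (Fin 2 × Fin 2) B :=
  Matrix.of fun p q => if p.swap = q then 1 else 0

theorem ampL_mul_ampR (T S : Matrix (Fin 2) (Fin 2) B) (p q : Fin 2 × Fin 2) :
    (ampL T * ampR S) p q = T p.1 q.1 * S p.2 q.2 := by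
  simp [ampL, ampR, Matrix.mul_apply, Fintype.sum_prod_type, ite_mul, mul_ite]

theorem ampR_mul_ampL (T S : Matrix (Fin 2) (Fin 2) B) (p q : Fin 2 × Fin 2) :
    (ampR S * ampL T) p q = S p.2 q.2 * T p.1 q.1 := by
  simp [ampL, ampR, Matrix.mul_apply, Fintype.sum_prod_type, ite_mul, mul_ite]

theorem flipM_mul (M : Matrix (Fin 2 × Fin 2) (Fin 2 × Fin 2) B) (p q : Fin 2 × Fin 2) :
    (flipM B * M) p q = M p.swap q := by
  simp [flipM, Matrix.mul_apply, ite_mul]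

theorem mul_flipM (M : Matrix (Fin 2 × Fin 2) (Fin 2 × Fin 2) B) (p q : Fin 2 × Fin 2) :
    (M * flipM B) p q = M p q.swap := by
  have : ∀ r : Fin 2 × Fin 2, r.swap = q ↔ r = q.swap := fun r =>
    ⟨fun h => by rw [← h, Prod.swap_swap], fun h => by rw [h, Prod.swap_swap]⟩
  simp [flipM, Matrix.mul_apply, mul_ite, this]

theorem flipM_mul_self : flipM B * flipM B = 1 := by
  ext p q
  rw [flipM_mul]
  simp [flipM, Matrix.one_apply]

theorem flipM_ampL (S : Matrix (Fin 2) (Fin 2) B) : flipM B * ampL S * flipM B = ampR S := by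
  ext p q
  rw [mul_flipM, flipM_mul]
  simp [ampL, ampR]

theorem flipM_ampR (S : Matrix (Fin 2) (Fin 2) B) : flipM B * ampR S * flipM B = ampL S := by
  ext p q
  rw [mul_flipM, flipM_mul]
  simp [ampL, ampR]

theorem ampL_mul (T T' : Matrix (Fin 2) (Fin 2) B) :
    ampL T * ampL T' = ampL (T * T' : Matrix (Fin 2) (Fin 2) B) := by
  ext p q
  simp [ampL, Matrix.mul_apply, Fintype.sum_prod_type]

theorem ampR_mul (T T' : Matrix (Fin 2) (Fin 2) B) :
    ampR T * ampR T' = ampR (T * T' : Matrix (Fin 2) (Fin 2) B) := by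
  ext p q
  simp [ampR, Matrix.mul_apply, Fintype.sum_prod_type]

theorem ampL_one : ampL (1 : Matrix (Fin 2) (Fin 2) B) = 1 := by
  ext ⟨p, p'⟩ ⟨q, q'⟩
  simp only [ampL, Matrix.of_apply, Matrix.one_apply, Prod.mk.injEq]
  split_ifs <;> simp_all

theorem ampR_one : ampR (1 : Matrix (Fin 2) (Fin 2) B) = 1 := by
  ext ⟨p, p'⟩ ⟨q, q'⟩
  simp only [ampR, Matrix.of_apply, Matrix.one_apply, Prod.mk.injEq]
  split_ifs <;> simp_all

theorem rtt_iff {x y h : K} {T S : Matrix (Fin 2) (Fin 2) B} :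
    RTT x y h T S ↔ (y + h) • ((x • 1 + h • flipM B) * (ampL T * ampR S)) =
      (x + h) • ((ampR S * ampL T) * (y • 1 + h • flipM B)) := by
  have key : ∀ p q : Fin 2 × Fin 2,
      ((y + h) • ((x • 1 + h • flipM B) * (ampL T * ampR S))) p q =
        (y + h) • (x • (T p.1 q.1 * S p.2 q.2) + h • (T p.2 q.1 * S p.1 q.2)) ∧
      ((x + h) • ((ampR S * ampL T) * (y • 1 + h • flipM B))) p q =
        (x + h) • (y • (S p.2 q.2 * T p.1 q.1) + h • (S p.2 q.1 * T p.1 q.2)) := by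
    intro p q
    simp only [add_mul, mul_add, smul_mul_assoc, mul_smul_comm, one_mul, mul_one,
      Matrix.smul_apply, Matrix.add_apply, flipM_mul, mul_flipM, ampL_mul_ampR, ampR_mul_ampL,
      Prod.fst_swap, Prod.snd_swap, and_self]
  constructor
  · intro H
    ext p q
    rw [(key p q).1, (key p q).2]
    exact H p.1 q.1 p.2 q.2
  · intro H i j k l
    have := congrFun (congrFun H (i, k)) (j, l)
    rwa [(key _ _).1, (key _ _).2] at this

/-- The relation with the two factors exchanged. -/
theorem RTT.swap (H : RTT x y h T S) (r : Reg B x y h) : RTT (-x) (-y) h S T := by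
  have P2 := flipM_mul_self (B := B)
  rw [rtt_iff] at H ⊢
  rw [← flipM_ampR S, ← flipM_ampL T]
  generalize flipM B = P at *
  generalize ampL T = T₁ at *
  generalize ampR S = S₂ at *
  have P2' : ∀ z, P * (P * z) = z := fun z => by rw [← mul_assoc, P2, one_mul]
  have h1 := congrArg (fun z => P * (((-x) • 1 + h • P) * z * ((-y) • 1 + h • P)) * P) H
  have h2 : (x + h) • (y + h) • (-y + h) •
        (((-x) • 1 + h • P) * (P * S₂ * P * (P * T₁ * P))) =
      (x + h) • (y + h) • (-x + h) • (P * T₁ * P * (P * S₂ * P) * ((-y) • 1 + h • P)) := by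
    simp only [add_mul, mul_add, smul_mul_assoc, mul_smul_comm, one_mul, mul_one, mul_assoc, P2,
      P2'] at h1 ⊢
    linear_combination (norm := module) -h1
  ext p q
  apply r.yp
  apply r.xp
  exact congrFun (congrFun h2 p) q

/-- The relation for the inverse matrices, in the opposite algebra. -/
theorem RTT.inv {T S T' S' : Matrix (Fin 2) (Fin 2) B} (H : RTT x y h T S)
    (hT : T * T' = 1)
    (hT' : T' * T = 1)
    (hS : S * S' = 1)
    (hS' : S' * S = 1) :
    RTT y x h (Matrix.of fun i j => MulOpposite.op (T' i j))
      (Matrix.of fun i j => MulOpposite.op (S' i j)) := by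
  have key : (x + h) • ((y • 1 + h • flipM B) * (ampR S' * ampL T')) =
      (y + h) • ((ampL T' * ampR S') * (x • 1 + h • flipM B)) := by
    rw [rtt_iff] at H
    have t1 : ampL T * ampL T' = 1 := by rw [ampL_mul, hT, ampL_one]
    have t2 : ampL T' * ampL T = 1 := by rw [ampL_mul, hT', ampL_one]
    have s1 : ampR S * ampR S' = 1 := by rw [ampR_mul, hS, ampR_one]
    have s2 : ampR S' * ampR S = 1 := by rw [ampR_mul, hS', ampR_one]
    generalize ampL T = T₁ at *
    generalize ampR S = S₂ at *
    generalize ampL T' = T₁' at *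
    generalize ampR S' = S₂' at *
    have h1 := congrArg (fun z => T₁' * (S₂' * z * S₂') * T₁') H
    have t2' : ∀ z, T₁' * (T₁ * z) = z := fun z => by rw [← mul_assoc, t2, one_mul]
    have s1' : ∀ z, S₂ * (S₂' * z) = z := fun z => by rw [← mul_assoc, s1, one_mul]
    have s2' : ∀ z, S₂' * (S₂ * z) = z := fun z => by rw [← mul_assoc, s2, one_mul]
    simp only [add_mul, mul_add, smul_mul_assoc, mul_smul_comm, one_mul, mul_one, mul_assoc,
      t1, t2', s1', s2'] at h1 ⊢
    exact h1.symm
  intro i j k l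
  have := congrFun (congrFun key (i, k)) (j, l)
  simp only [add_mul, mul_add, smul_mul_assoc, mul_smul_comm, one_mul, mul_one,
      Matrix.smul_apply, Matrix.add_apply, flipM_mul, mul_flipM, ampL_mul_ampR, ampR_mul_ampL,
      Prod.fst_swap, Prod.snd_swap] at this
  simp only [Matrix.of_apply, ← MulOpposite.op_mul, ← MulOpposite.op_smul, ← MulOpposite.op_add]
  rw [this]

theorem RTT.e_a (H : RTT x y h T S) (r : Reg B x y h) (HT : IsGauss T a d e f)
    (HS : IsGauss S a' d' e' f') : y • (e * a') = (y - h) • (a' * e) + h • (a' * e') := by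
  have := (H.swap r).a_e r.neg HS HT
  linear_combination (norm := module) this

theorem RTT.f_a (H : RTT x y h T S) (r : Reg B x y h) (HT : IsGauss T a d e f)
    (HS : IsGauss S a' d' e' f') : x • (a' * f) = (x - h) • (f * a') + h • (f' * a') := by
  have := (H.swap r).a_f r.neg HS HT
  linear_combination (norm := module) -this

theorem RTT.e_e (H : RTT x y h T S) (r : Reg B x y h) (HT : IsGauss T a d e f)
    (HS : IsGauss S a' d' e' f') :
    (y - h) • (e * e') - (y + h) • (e' * e) = -(h • (e * e + e' * e')) := by
  have hc := H.a_comm r HT HS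
  have h1 := H.diag_comm r 0 1
  have h2 := congrArg (fun z => a * z * e') (H.e_a r HT HS)
  have h3 := congrArg (fun z => a' * z * e) (H.a_e r HT HS)
  simp only [HT.t01, HS.t01] at h1
  apply (HT.unit_a.mul HS.unit_a).mul_left_cancel
  have hc' : ∀ z, a' * (a * z) = a * (a' * z) := fun z => by rw [← mul_assoc, ← hc, mul_assoc]
  simp only [mul_add, mul_sub, mul_neg, add_mul, mul_smul_comm, smul_mul_assoc, mul_assoc, hc']
    at h1 h2 h3 ⊢
  linear_combination (norm := module) y • h1 - h2 - h3

theorem RTT.f_f (H : RTT x y h T S) (r : Reg B x y h) (HT : IsGauss T a d e f)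
    (HS : IsGauss S a' d' e' f') :
    (x + h) • (f * f') - (x - h) • (f' * f) = h • (f * f + f' * f') := by
  have hc := H.a_comm r HT HS
  have h1 := H.diag_comm r 1 0
  have h2 := congrArg (fun z => f * z * a') (H.a_f r HT HS)
  have h3 := congrArg (fun z => f' * z * a) (H.f_a r HT HS)
  simp only [HT.t10, HS.t10] at h1
  apply (HT.unit_a.mul HS.unit_a).mul_right_cancel
  simp only [mul_add, mul_sub, add_mul, sub_mul, mul_smul_comm, smul_mul_assoc, mul_assoc, hc]
    at h1 h2 h3 ⊢
  linear_combination (norm := module) x • h1 - h2 + h3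

theorem RTT.a_d (H : RTT x y h T S) (r : Reg B x y h) (HT : IsGauss T a d e f)
    (HS : IsGauss S a' d' e' f') :
    (y + h) • x • (a * d') = (x + h) • y • (d' * a) := by
  have hc := H.a_comm r HT HS
  have h1 := H 0 0 1 1
  have h2 := congrArg (fun z => z * a' * e') (H.a_f r HT HS)
  have h3 := congrArg (fun z => f' * a' * z) (H.a_e r HT HS)
  simp only [HT.t00, HT.t01, HS.t01, HT.t10, HS.t10, HS.t11] at h1
  have hc' : ∀ z, a' * (a * z) = a * (a' * z) := fun z => by rw [← mul_assoc, ← hc, mul_assoc]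
  simp only [mul_add, add_mul, sub_mul, mul_smul_comm, smul_mul_assoc, mul_assoc, hc']
    at h1 h2 h3 ⊢
  linear_combination (norm := module) h1 - (y + h) • h2 - (x + h) • h3

theorem RTT.a_dinv (H : RTT x y h T S) (r : Reg B x y h) (HT : IsGauss T a d e f)
    (HS : IsGauss S a' d' e' f') {q : B} (hq : q * d' = 1) (hq' : d' * q = 1) :
    (y + h) • x • (q * a) = (x + h) • y • (a * q) := by
  have h1 := congrArg (fun z => q * z * q) (H.a_d r HT HS)
  have e1 : q * (a * (d' * q)) = q * a := by rw [hq', mul_one]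
  have e2 : q * (d' * (a * q)) = a * q := by rw [← mul_assoc, hq, one_mul]
  simpa only [mul_smul_comm, smul_mul_assoc, mul_assoc, e1, e2] using h1

theorem RTT.e_f (H : RTT x y h T S) (r : Reg B x y h) (HT : IsGauss T a d e f)
    (HS : IsGauss S a' d' e' f') (hd : d * a = a * d) {b b' : B}
    (hb : b * a = 1) (hb' : b' * a' = 1) (hbr : a * b = 1) :
    x • y • (e * f' - f' * e) = h • (x • (d' * b') - y • (d * b)) := by
  have hc := H.a_comm r HT HS
  have h1 := H 0 1 1 0
  simp only [HT.t00, HS.t00, HT.t01, HS.t10, HT.t11, HS.t11] at h1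
  have h2 := congrArg (fun z => f * a * z) (H.e_a r HT HS)
  have h3 := congrArg (fun z => f' * a' * z) (H.a_e r HT HS)
  have h4 := congrArg (fun z => z * a' * e) (H.a_f r HT HS)
  have h5 := congrArg (fun z => z * a' * e') (H.a_f r HT HS)
  have h6 := congrArg (fun z => a * f' * z) (H.e_a r HT HS)
  have h7 := H.a_d r HT HS
  have hd' : d * b = b * d := by
    have := congrArg (fun z => b * z * b) hd
    simp only [mul_assoc, hbr, mul_one] at this
    rw [← mul_assoc b a, hb, one_mul] at this
    exact this.symm
  apply HT.unit_a.mul_left_cancel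
  apply HS.unit_a.mul_right_cancel
  apply r.yp
  have e1 : a * (d * (b * a')) = d * a' := by
    rw [← mul_assoc d b, hd', mul_assoc, ← mul_assoc a b, hbr, one_mul]
  have hc' : ∀ z, a' * (a * z) = a * (a' * z) := fun z => by rw [← mul_assoc, ← hc, mul_assoc]
  simp only [mul_add, mul_sub, add_mul, sub_mul, mul_smul_comm, smul_mul_assoc, mul_assoc, hc', hb',
    hc, e1, mul_one, smul_sub, smul_add]
    at h1 h2 h3 h4 h5 h6 h7 ⊢
  linear_combination (norm := module) y • h1 - ((y + h) * h) • h2 - ((x + h) * h) • h3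
    - ((y + h) * (y - h)) • h4 - ((y + h) * h) • h5 - ((y + h) * x) • h6 - h • h7

/-- The inverse of a matrix with Gauss coordinates `a, d, e, f`, where `b = a⁻¹`, `q = d⁻¹`. -/
def gaussInv (b q e f : B) : Matrix (Fin 2) (Fin 2) B :=
  !![b + e * q * f, -(e * q); -(q * f), q]

theorem IsGauss.mul_gaussInv {T : Matrix (Fin 2) (Fin 2) B} (HT : IsGauss T a d e f) {b q : B}
    (hab : a * b = 1) (hdq : d * q = 1) : T * gaussInv b q e f = 1 := by
  have hdq' : ∀ z, d * (q * z) = z := fun z => by rw [← mul_assoc, hdq, one_mul]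
  ext i j
  fin_cases i <;> fin_cases j <;>
    simp [Matrix.mul_apply, gaussInv, HT.t00, HT.t01, HT.t10, HT.t11, mul_add, add_mul, mul_assoc,
      hab, hdq, hdq']

theorem IsGauss.gaussInv_mul {T : Matrix (Fin 2) (Fin 2) B} (HT : IsGauss T a d e f) {b q : B}
    (hba : b * a = 1) (hqd : q * d = 1) : gaussInv b q e f * T = 1 := by
  have hba' : ∀ z, b * (a * z) = z := fun z => by rw [← mul_assoc, hba, one_mul]
  ext i j
  fin_cases i <;> fin_cases j <;>
    simp [Matrix.mul_apply, gaussInv, HT.t00, HT.t01, HT.t10, HT.t11, mul_add, add_mul, mul_assoc,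
      hba, hqd, hba', add_assoc]

/-- The matrix in the opposite algebra to which `RTT.inv` applies, with the indices exchanged. -/
def opInv (b q e f : B) : Matrix (Fin 2) (Fin 2) Bᵐᵒᵖ :=
  Matrix.of fun i j => MulOpposite.op (gaussInv b q e f i.rev j.rev)

theorem isGauss_opInv {b q : B} (hqd : q * d = 1) (hdq : d * q = 1) :
    ∃ d₀, IsGauss (opInv b q e f) (MulOpposite.op q) d₀
      (MulOpposite.op (-(q * f * d))) (MulOpposite.op (-(d * e * q))) := by
  have hqd' : ∀ z, q * (d * z) = z := fun z => by rw [← mul_assoc, hqd, one_mul]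
  refine ⟨opInv b q e f 1 1 - MulOpposite.op (-(d * e * q)) * MulOpposite.op q *
    MulOpposite.op (-(q * f * d)), ?_, ?_, ?_, ?_, ?_⟩
  · simp [opInv, gaussInv]
  · simp [opInv, gaussInv, ← MulOpposite.op_mul, mul_assoc, hdq]
  · simp [opInv, gaussInv, ← MulOpposite.op_mul, mul_assoc, hqd']
  · simp
  · exact IsUnit.op ⟨⟨q, d, hqd, hdq⟩, rfl⟩

theorem RTT.opInv (H : RTT x y h T S) (HT : IsGauss T a d e f) (HS : IsGauss S a' d' e' f')
    {b q b' q' : B} (hab : a * b = 1) (hba : b * a = 1) (hdq : d * q = 1) (hqd : q * d = 1)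
    (hab' : a' * b' = 1) (hba' : b' * a' = 1) (hdq' : d' * q' = 1) (hqd' : q' * d' = 1) :
    RTT y x h (opInv b q e f) (opInv b' q' e' f') := fun i j k l =>
  RTT.inv H (HT.mul_gaussInv hab hdq) (HT.gaussInv_mul hba hqd) (HS.mul_gaussInv hab' hdq')
    (HS.gaussInv_mul hba' hqd') i.rev j.rev k.rev l.rev

theorem Reg.op (r : Reg B x y h) : Reg Bᵐᵒᵖ x y h := by
  have key : ∀ {z : K}, IsSMulRegular B z → IsSMulRegular Bᵐᵒᵖ z := fun hz m n hmn =>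
    MulOpposite.unop_injective (hz (congrArg MulOpposite.unop hmn))
  exact ⟨key r.rx, key r.ry, key r.xp, key r.yp, key r.xm, key r.ym⟩

/-- Gauss coordinates of two matrices together with the inverses of the diagonal ones. -/
structure GaussPair (x y h : K) (T S : Matrix (Fin 2) (Fin 2) B) (a b d q e f a' b' d' q' e' f' : B) :
    Prop where
  rtt : RTT x y h T S
  reg : Reg B x y h
  gl : IsGauss T a d e f
  gr : IsGauss S a' d' e' f'
  ab : a * b = 1
  ba : b * a = 1
  dq : d * q = 1
  qd : q * d = 1
  ab' : a' * b' = 1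
  ba' : b' * a' = 1
  dq' : d' * q' = 1
  qd' : q' * d' = 1

namespace GaussPair

variable {b q b' q' : B}

theorem swap (G : GaussPair x y h T S a b d q e f a' b' d' q' e' f') :
    GaussPair (-x) (-y) h S T a' b' d' q' e' f' a b d q e f :=
  ⟨G.rtt.swap G.reg, G.reg.neg, G.gr, G.gl, G.ab', G.ba', G.dq', G.qd', G.ab, G.ba, G.dq, G.qd⟩

theorem opInv (G : GaussPair x y h T S a b d q e f a' b' d' q' e' f') :
    RTT y x h (opInv b q e f) (YangianDouble.opInv b' q' e' f') :=
  G.rtt.opInv G.gl G.gr G.ab G.ba G.dq G.qd G.ab' G.ba' G.dq' G.qd'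

theorem q_comm (G : GaussPair x y h T S a b d q e f a' b' d' q' e' f') : q * q' = q' * q := by
  obtain ⟨_, h1⟩ := isGauss_opInv (b := b) (e := e) (f := f) G.qd G.dq
  obtain ⟨_, h2⟩ := isGauss_opInv (b := b') (e := e') (f := f') G.qd' G.dq'
  have := congrArg MulOpposite.unop (G.opInv.a_comm (Reg.symm G.reg).op h1 h2)
  simpa using this.symm

theorem d_comm (G : GaussPair x y h T S a b d q e f a' b' d' q' e' f') : d * d' = d' * d := by
  refine (left_inv_eq_right_inv (a := q * q') (b := d' * d) (c := d * d') ?_ ?_).symm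
  · rw [mul_assoc, ← mul_assoc d, G.dq, one_mul, G.dq']
  · rw [G.q_comm, mul_assoc, ← mul_assoc q, G.qd, one_mul, G.qd']

theorem d_q (G : GaussPair x y h T S a b d q e f a' b' d' q' e' f') : d' * q = q * d' := by
  have := congrArg (fun z => d' * z * d') G.q_comm
  simp only [mul_assoc, G.qd', mul_one] at this
  rw [this, ← mul_assoc d', G.dq', one_mul]

theorem d_f_conj (G : GaussPair x y h T S a b d q e f a' b' d' q' e' f') :
    (x + h) • (d * f' * q) = x • f' + h • (d' * f * q') := by
  obtain ⟨_, h1⟩ := isGauss_opInv (b := b) (e := e) (f := f) G.qd G.dq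
  obtain ⟨_, h2⟩ := isGauss_opInv (b := b') (e := e') (f := f') G.qd' G.dq'
  have := congrArg MulOpposite.unop (G.opInv.a_e (Reg.symm G.reg).op h1 h2)
  simp only [← MulOpposite.op_mul, ← MulOpposite.op_smul, ← MulOpposite.op_add,
    MulOpposite.unop_op] at this
  have hx : ∀ z, d' * (q * z) = q * (d' * z) := fun z => by rw [← mul_assoc, G.d_q, mul_assoc]
  have h1 : ∀ z, d * (q * z) = z := fun z => by rw [← mul_assoc, G.dq, one_mul]
  have h2 : ∀ z, d' * (q' * z) = z := fun z => by rw [← mul_assoc, G.dq', one_mul]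
  have := congrArg (fun z => -(d * (d' * z) * q')) this
  simpa only [mul_assoc, mul_neg, neg_mul, smul_neg, mul_add, add_mul, mul_smul_comm,
    smul_mul_assoc, neg_neg, neg_add, hx, h1, h2, G.dq', mul_one] using this

theorem e_d_conj (G : GaussPair x y h T S a b d q e f a' b' d' q' e' f') :
    (y + h) • (q * e' * d) = y • e' + h • (q' * e * d') := by
  obtain ⟨_, h1⟩ := isGauss_opInv (b := b) (e := e) (f := f) G.qd G.dq
  obtain ⟨_, h2⟩ := isGauss_opInv (b := b') (e := e') (f := f') G.qd' G.dq'
  have := congrArg MulOpposite.unop (G.opInv.a_f (Reg.symm G.reg).op h1 h2)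
  simp only [← MulOpposite.op_mul, ← MulOpposite.op_smul, ← MulOpposite.op_sub,
    MulOpposite.unop_op] at this
  have hx : ∀ z, q' * (q * z) = q * (q' * z) := fun z => by rw [← mul_assoc, ← G.q_comm, mul_assoc]
  have hy : ∀ z, q' * (d * z) = d * (q' * z) := fun z => by
    have := G.swap.d_q
    rw [← mul_assoc, ← this, mul_assoc]
  have h1 : ∀ z, q * (d * z) = z := fun z => by rw [← mul_assoc, G.qd, one_mul]
  have h2 : ∀ z, q' * (d' * z) = z := fun z => by rw [← mul_assoc, G.qd', one_mul]
  have := congrArg (fun z => q' * z * (d * d')) this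
  simp only [mul_assoc, mul_neg, neg_mul, smul_neg, mul_sub, sub_mul, mul_smul_comm,
    smul_mul_assoc, hx, hy, h1, h2, G.qd', mul_one] at this ⊢
  linear_combination (norm := module) this

theorem d_f (G : GaussPair x y h T S a b d q e f a' b' d' q' e' f') :
    x • (d * f' * q) = (x - h) • f' + h • f := by
  apply G.reg.rx
  simp only
  linear_combination (norm := module) (x - h) • G.d_f_conj - h • G.swap.d_f_conj

theorem e_d (G : GaussPair x y h T S a b d q e f a' b' d' q' e' f') :
    y • (q * e' * d) = (y - h) • e' + h • e := by
  apply G.reg.ry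
  simp only
  linear_combination (norm := module) (y - h) • G.e_d_conj - h • G.swap.e_d_conj

end GaussPair

end Gauss
end YangianDouble

namespace YangianDouble

section Centralizer

variable {B : Type*} [Ring B]

/-- The matrix with Gauss coordinates `a, d, e, f`. -/
def gaussMat (a d e f : B) : Matrix (Fin 2) (Fin 2) B := !![a, a * e; f * a, d + f * a * e]

theorem gaussMat_map {B' : Type*} [Ring B'] (φ : B →+* B') (a d e f : B) (i j : Fin 2) :
    φ (gaussMat a d e f i j) = gaussMat (φ a) (φ d) (φ e) (φ f) i j := by
  fin_cases i <;> fin_cases j <;> simp [gaussMat]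

/-- Gauss coordinates (with inverses) of two matrices subject to the `RTT`-relation, where the
scalars `x, y, h` commute with all of the coordinates. -/
structure GaussData (x y h : B) (a b d q e f a' b' d' q' e' f' : B) : Prop where
  scal : ∀ s ∈ ({x, y, h} : Set B), ∀ z ∈ ({x, y, h, a, b, d, q, e, f, a', b', d', q', e', f'} : Set B),
    s * z = z * s
  rtt : ∀ i j k l, (y + h) * (x * (gaussMat a d e f i j * gaussMat a' d' e' f' k l) +
      h * (gaussMat a d e f k j * gaussMat a' d' e' f' i l)) =
    (x + h) * (y * (gaussMat a' d' e' f' k l * gaussMat a d e f i j) +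
      h * (gaussMat a' d' e' f' k j * gaussMat a d e f i l))
  reg : ∀ s ∈ ({x, y, x + h, y + h, x - h, y - h} : Set B), IsLeftRegular s
  ab : a * b = 1
  ba : b * a = 1
  dq : d * q = 1
  qd : q * d = 1
  ab' : a' * b' = 1
  ba' : b' * a' = 1
  dq' : d' * q' = 1
  qd' : q' * d' = 1

namespace GaussData

variable {x y h a b d q e f a' b' d' q' e' f' : B}

theorem exists_gaussPair (G : GaussData x y h a b d q e f a' b' d' q' e' f') :
    ∃ (Z : Subring B) (X Y H : Subring.center Z) (A B' D Q E F A' B'' D' Q' E' F' : Z),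
      GaussPair X Y H (gaussMat A D E F) (gaussMat A' D' E' F')
        A B' D Q E F A' B'' D' Q' E' F' ∧
      (((X : Z) : B) = x ∧ ((Y : Z) : B) = y ∧ ((H : Z) : B) = h) ∧
      ((A : B) = a ∧ (B' : B) = b ∧ (D : B) = d ∧ (Q : B) = q ∧ (E : B) = e ∧ (F : B) = f) ∧
      ((A' : B) = a' ∧ (B'' : B) = b' ∧ (D' : B) = d' ∧ (Q' : B) = q' ∧ (E' : B) = e' ∧
        (F' : B) = f') := by
  let Z : Subring B := Subring.centralizer {x, y, h}
  have hZ : ∀ z ∈ ({x, y, h, a, b, d, q, e, f, a', b', d', q', e', f'} : Set B), z ∈ Z :=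
    fun z hz => Subring.mem_centralizer_iff.2 fun s hs => G.scal s hs z hz
  have hK : ∀ s (hs : s ∈ ({x, y, h} : Set B)) (hs' : s ∈ Z), (⟨s, hs'⟩ : Z) ∈ Subring.center Z :=
    fun s hs hs' => Subring.mem_center_iff.2 fun z =>
      Subtype.ext (Subring.mem_centralizer_iff.1 z.2 s hs).symm
  refine ⟨Z, ⟨⟨x, hZ x (by simp)⟩, hK x (by simp) _⟩, ⟨⟨y, hZ y (by simp)⟩, hK y (by simp) _⟩,
    ⟨⟨h, hZ h (by simp)⟩, hK h (by simp) _⟩, ⟨a, hZ a (by simp)⟩, ⟨b, hZ b (by simp)⟩,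
    ⟨d, hZ d (by simp)⟩, ⟨q, hZ q (by simp)⟩, ⟨e, hZ e (by simp)⟩, ⟨f, hZ f (by simp)⟩,
    ⟨a', hZ a' (by simp)⟩, ⟨b', hZ b' (by simp)⟩, ⟨d', hZ d' (by simp)⟩, ⟨q', hZ q' (by simp)⟩,
    ⟨e', hZ e' (by simp)⟩, ⟨f', hZ f' (by simp)⟩, ?_, by simp, by simp, by simp⟩
  have hreg : ∀ (s : Subring.center Z), ((s : Z) : B) ∈ ({x, y, x + h, y + h, x - h, y - h} : Set B) →
      IsSMulRegular Z s := fun s hs m n hmn =>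
    Subtype.ext (G.reg _ hs (congrArg Subtype.val hmn))
  refine ⟨?_, ⟨hreg _ (by simp), hreg _ (by simp), hreg _ (by simp), hreg _ (by simp),
    hreg _ (by simp), hreg _ (by simp)⟩, ?_, ?_, Subtype.ext G.ab, Subtype.ext G.ba,
    Subtype.ext G.dq, Subtype.ext G.qd, Subtype.ext G.ab', Subtype.ext G.ba', Subtype.ext G.dq',
    Subtype.ext G.qd'⟩
  · intro i j k l
    have := G.rtt i j k l
    have hm : ∀ (a d e f : Z) i j, ((gaussMat a d e f i j : Z) : B) = gaussMat (a : B) d e f i j :=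
      fun a d e f i j => gaussMat_map Z.subtype a d e f i j
    apply Subtype.ext
    simp only [Algebra.smul_def]
    change (y + h) * (x * (((_ : Z) : B) * ((_ : Z) : B)) + h * (((_ : Z) : B) * ((_ : Z) : B))) =
      (x + h) * (y * (((_ : Z) : B) * ((_ : Z) : B)) + h * (((_ : Z) : B) * ((_ : Z) : B)))
    simp only [hm]
    exact this
  · exact ⟨rfl, rfl, rfl, rfl, ⟨⟨⟨a, hZ a (by simp)⟩, ⟨b, hZ b (by simp)⟩,
      Subtype.ext G.ab, Subtype.ext G.ba⟩, rfl⟩⟩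
  · exact ⟨rfl, rfl, rfl, rfl, ⟨⟨⟨a', hZ a' (by simp)⟩, ⟨b', hZ b' (by simp)⟩,
      Subtype.ext G.ab', Subtype.ext G.ba'⟩, rfl⟩⟩

theorem swap_rtt (G : GaussData x y h a b d q e f a' b' d' q' e' f') (i j k l : Fin 2) :
    (y - h) * (x * (gaussMat a' d' e' f' i j * gaussMat a d e f k l) -
      h * (gaussMat a' d' e' f' k j * gaussMat a d e f i l)) =
    (x - h) * (y * (gaussMat a d e f k l * gaussMat a' d' e' f' i j) -
      h * (gaussMat a d e f k j * gaussMat a' d' e' f' i l)) := by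
  obtain ⟨Z, X, Y, H, A, B₁, D, Q, E, F, A', B', D', Q', E', F', P, ⟨rfl, rfl, rfl⟩,
    ⟨rfl, rfl, rfl, rfl, rfl, rfl⟩, ⟨rfl, rfl, rfl, rfl, rfl, rfl⟩⟩ := G.exists_gaussPair
  have hm : ∀ (a d e f : Z) i j, ((gaussMat a d e f i j : Z) : B) = gaussMat (a : B) d e f i j :=
    fun a d e f i j => gaussMat_map Z.subtype a d e f i j
  simp only [← hm]
  have h0 := P.swap.rtt i j k l
  have h1 : (Y - H) • (X • (gaussMat A' D' E' F' i j * gaussMat A D E F k l) -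
      H • (gaussMat A' D' E' F' k j * gaussMat A D E F i l)) =
    (X - H) • (Y • (gaussMat A D E F k l * gaussMat A' D' E' F' i j) -
      H • (gaussMat A D E F k j * gaussMat A' D' E' F' i l)) := by
    linear_combination (norm := module) h0
  exact congrArg Subtype.val h1

theorem relations (G : GaussData x y h a b d q e f a' b' d' q' e' f') :
    a * a' = a' * a ∧
    d * d' = d' * d ∧
    (y + h) * (x * (q' * a)) = (x + h) * (y * (a * q')) ∧
    y * (b * e' * a) = (y + h) * e' - h * e ∧
    x * (a * f' * b) = (x + h) * f' - h * f ∧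
    y * (q * e' * d) = (y - h) * e' + h * e ∧
    x * (d * f' * q) = (x - h) * f' + h * f ∧
    (y - h) * (e * e') - (y + h) * (e' * e) = -(h * (e * e + e' * e')) ∧
    (x + h) * (f * f') - (x - h) * (f' * f) = h * (f * f + f' * f') ∧
    (d * a = a * d → x * (y * (e * f' - f' * e)) = h * (x * (d' * b') - y * (d * b))) := by
  obtain ⟨Z, X, Y, H, A, B₁, D, Q, E, F, A', B', D', Q', E', F', P, ⟨rfl, rfl, rfl⟩,
    ⟨rfl, rfl, rfl, rfl, rfl, rfl⟩, ⟨rfl, rfl, rfl, rfl, rfl, rfl⟩⟩ := G.exists_gaussPair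
  have e1 := congrArg (B₁ * ·) (P.rtt.a_e P.reg P.gl P.gr)
  have f1 := congrArg (· * B₁) (P.rtt.a_f P.reg P.gl P.gr)
  have hB : ∀ z, B₁ * (A * z) = z := fun z => by rw [← mul_assoc, P.ba, one_mul]
  simp only [mul_smul_comm, mul_add, hB, smul_mul_assoc, sub_mul, mul_assoc, P.ab,
    mul_one] at e1 f1
  have e1' : Y • (B₁ * E' * A) = (Y + H) • E' - H • E := by
    rw [mul_assoc]; linear_combination (norm := module) -e1
  have f1' : X • (A * F' * B₁) = (X + H) • F' - H • F := by
    rw [mul_assoc]; linear_combination (norm := module) f1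
  exact ⟨congrArg Subtype.val (P.rtt.a_comm P.reg P.gl P.gr), congrArg Subtype.val P.d_comm,
    congrArg Subtype.val (P.rtt.a_dinv P.reg P.gl P.gr P.qd' P.dq'), congrArg Subtype.val e1',
    congrArg Subtype.val f1', congrArg Subtype.val P.e_d, congrArg Subtype.val P.d_f,
    congrArg Subtype.val (P.rtt.e_e P.reg P.gl P.gr),
    congrArg Subtype.val (P.rtt.f_f P.reg P.gl P.gr),
    fun hd => congrArg Subtype.val
      (P.rtt.e_f P.reg P.gl P.gr (Subtype.ext hd) P.ba P.ba' P.ab)⟩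

end GaussData

end Centralizer

end YangianDouble

namespace YangianDouble

section Laurent

variable {A : Type*} [Ring A]

/-- Laurent series in `v^{∓1}` whose coefficients are Laurent series in `u^{∓1}`. -/
abbrev BiLaurent (A : Type*) [Ring A] := HahnSeries ℤ (HahnSeries ℤ A)

namespace BiLaurent

/-- The variable `u`, where the Laurent series in `u` are expanded in powers of `u^{∓1}`. -/
noncomputable def u (σ : Sgn) : BiLaurent A := HahnSeries.C (HahnSeries.single (-σ.val) 1)

/-- The variable `v`. -/
noncomputable def v (τ : Sgn) : BiLaurent A := HahnSeries.single (-τ.val) 1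

/-- Constants. -/
noncomputable def cst : A →+* BiLaurent A := HahnSeries.C.comp HahnSeries.C

/-- Power series in `u^{∓1}`. -/
noncomputable def inclU : A⟦X⟧ →+* BiLaurent A :=
  HahnSeries.C.comp (HahnSeries.ofPowerSeries ℤ A)

/-- Power series in `v^{∓1}`. -/
noncomputable def inclV : A⟦X⟧ →+* BiLaurent A :=
  (HahnSeries.ofPowerSeries ℤ (HahnSeries ℤ A)).comp (PowerSeries.map HahnSeries.C)

/-- The two-sided formal series defined by a Laurent series. -/
def toBiDist (σ τ : Sgn) (F : BiLaurent A) : BiDist A :=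
  fun a b => (F.coeff (-(τ.val * b))).coeff (-(σ.val * a))

end BiLaurent

open BiLaurent

theorem Sgn.val_mul_self (σ : Sgn) : σ.val * σ.val = 1 := by cases σ <;> rfl

theorem ser_eq (σ : Sgn) (p : A⟦X⟧) (a : ℤ) :
    ser σ p a = (HahnSeries.ofPowerSeries ℤ A p).coeff (-(σ.val * a)) := by
  have neg : ∀ n : ℤ, n < 0 → (HahnSeries.ofPowerSeries ℤ A p).coeff n = 0 := by
    intro n hn
    rw [HahnSeries.ofPowerSeries_apply]
    apply HahnSeries.embDomain_of_notMem_range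
    rintro ⟨m, hm⟩
    simp at hm
    omega
  have pos : ∀ n : ℤ, 0 ≤ n →
      (HahnSeries.ofPowerSeries ℤ A p).coeff n = PowerSeries.coeff n.toNat p := by
    intro n hn
    rw [← HahnSeries.ofPowerSeries_apply_coeff (Γ := ℤ), Int.toNat_of_nonneg hn]
  cases σ
  · simp only [ser, Sgn.val, one_mul]
    split_ifs with h
    · rw [pos _ (by omega)]
    · rw [neg _ (by omega)]
  · simp only [ser, Sgn.val, neg_one_mul, neg_neg]
    split_ifs with h
    · rw [pos _ h]
    · rw [neg _ (by omega)]

theorem ser_support (σ : Sgn) (p : A⟦X⟧) (a : ℤ) (h : 0 < σ.val * a) : ser σ p a = 0 := by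
  cases σ <;> simp [ser, Sgn.val] at h ⊢ <;> omega

theorem coeff_C_mul_mul_C (P R : HahnSeries ℤ A) (F : BiLaurent A) (n : ℤ) :
    (HahnSeries.C P * F * HahnSeries.C R).coeff n = P * F.coeff n * R := by
  simp [HahnSeries.C_apply]

theorem coeff_inclV (τ : Sgn) (q : A⟦X⟧) (b : ℤ) :
    (inclV q).coeff (-(τ.val * b)) = HahnSeries.C (ser τ q b) := by
  rw [inclV, RingHom.comp_apply, ← ser_eq]
  cases τ <;> simp only [ser] <;> split_ifs <;> simp

theorem toBiDist_sandwich (σ τ : Sgn) (p q r : A⟦X⟧) (a b : ℤ) :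
    toBiDist σ τ (inclU p * inclV q * inclU r) a b =
      ser σ (p * PowerSeries.C (ser τ q b) * r) a := by
  rw [toBiDist, inclU, RingHom.comp_apply, RingHom.comp_apply, coeff_C_mul_mul_C, coeff_inclV,
    ser_eq σ, map_mul, map_mul, HahnSeries.ofPowerSeries_C]

theorem toBiDist_injective (σ τ : Sgn) :
    Function.Injective (toBiDist σ τ : BiLaurent A → BiDist A) := by
  intro F G h
  ext m n
  have := congrFun (congrFun h (-(σ.val * n))) (-(τ.val * m))
  simpa [toBiDist, ← mul_assoc, Sgn.val_mul_self] using this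

theorem toBiDist_add (σ τ : Sgn) (F G : BiLaurent A) :
    toBiDist σ τ (F + G) = toBiDist σ τ F + toBiDist σ τ G := by
  ext a b; simp [toBiDist]

theorem toBiDist_sub (σ τ : Sgn) (F G : BiLaurent A) :
    toBiDist σ τ (F - G) = toBiDist σ τ F - toBiDist σ τ G := by
  ext a b; simp [toBiDist]

theorem toBiDist_neg (σ τ : Sgn) (F : BiLaurent A) :
    toBiDist σ τ (-F) = -toBiDist σ τ F := by
  ext a b; simp [toBiDist]

theorem toBiDist_cst_mul (σ τ : Sgn) (s : A) (F : BiLaurent A) (a b : ℤ) :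
    toBiDist σ τ (cst s * F) a b = s * toBiDist σ τ F a b := by
  simp [toBiDist, cst, HahnSeries.C_apply]

theorem toBiDist_lin (σ τ : Sgn) (s : A) (F : BiLaurent A) :
    toBiDist σ τ ((u σ - v τ + cst s) * F) = lin s (toBiDist σ τ F) := by
  ext a b
  rw [add_mul, sub_mul, toBiDist_add, toBiDist_sub]
  simp only [lin, Pi.add_apply, Pi.sub_apply, toBiDist_cst_mul]
  congr 2
  · rw [toBiDist, u, HahnSeries.C_apply, HahnSeries.coeff_single_zero_mul,
      HahnSeries.coeff_single_mul, one_mul, toBiDist]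
    congr 1; ring
  · rw [toBiDist, v, HahnSeries.coeff_single_mul, one_mul, toBiDist]
    congr 2; ring

theorem toBiDist_outer (σ τ : Sgn) (p q : A⟦X⟧) :
    toBiDist σ τ (inclU p * inclV q) = outer (ser σ p) (ser τ q) := by
  ext a b
  rw [← mul_one (inclU p * inclV q), ← map_one inclU, toBiDist_sandwich, mul_one, ser_eq σ, map_mul,
    HahnSeries.ofPowerSeries_C, outer, ser_eq σ]
  simp [HahnSeries.C_apply]

theorem toBiDist_outerRev (σ τ : Sgn) (p q : A⟦X⟧) :
    toBiDist σ τ (inclV q * inclU p) = outerRev (ser σ p) (ser τ q) := by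
  ext a b
  rw [← one_mul (inclV q), ← map_one inclU, toBiDist_sandwich, one_mul, ser_eq σ, map_mul,
    HahnSeries.ofPowerSeries_C, outerRev, ser_eq σ]
  simp [HahnSeries.C_apply]

theorem toBiDist_inclU (σ τ : Sgn) (p : A⟦X⟧) : toBiDist σ τ (inclU p) = inU (ser σ p) := by
  ext a b
  rw [← mul_one (inclU p), ← map_one inclV, toBiDist_outer]
  cases τ <;> simp only [outer, ser, inU, PowerSeries.coeff_one] <;> split_ifs <;>
    first | omega | simp

theorem toBiDist_inclV (σ τ : Sgn) (q : A⟦X⟧) : toBiDist σ τ (inclV q) = inV (ser τ q) := by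
  ext a b
  rw [← one_mul (inclV q), ← map_one inclU, toBiDist_outer]
  cases σ <;> simp only [outer, ser, inV, PowerSeries.coeff_one] <;> split_ifs <;>
    first | omega | simp

theorem u_comm (σ : Sgn) (F : BiLaurent A) : u σ * F = F * u σ := by
  ext m n
  rw [u, HahnSeries.C_apply, HahnSeries.coeff_single_zero_mul, HahnSeries.coeff_mul_single_zero,
    HahnSeries.coeff_single_mul, HahnSeries.coeff_mul_single, one_mul, mul_one]

theorem v_comm (σ : Sgn) (F : BiLaurent A) : v σ * F = F * v σ := by
  ext m n
  rw [v, HahnSeries.coeff_single_mul, HahnSeries.coeff_mul_single, one_mul, mul_one]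

theorem C_mul_comm {s : A} {p : A⟦X⟧} (h : ∀ n, Commute s (PowerSeries.coeff n p)) :
    PowerSeries.C s * p = p * PowerSeries.C s := by
  ext n
  simpa using (h n).eq

theorem cst_inclU_comm {s : A} {p : A⟦X⟧} (h : ∀ n, Commute s (PowerSeries.coeff n p)) :
    cst s * inclU p = inclU p * cst s := by
  have : cst s = inclU (PowerSeries.C s) := by simp [cst, inclU]
  rw [this, ← map_mul, C_mul_comm h, map_mul]

theorem cst_inclV_comm {s : A} {p : A⟦X⟧} (h : ∀ n, Commute s (PowerSeries.coeff n p)) :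
    cst s * inclV p = inclV p * cst s := by
  have : cst s = inclV (PowerSeries.C s) := by simp [cst, inclV]
  rw [this, ← map_mul, C_mul_comm h, map_mul]

end Laurent

end YangianDouble

noncomputable section

namespace YangianDouble

section Series

variable {A : Type*} [Ring A]

theorem lin_add (s : A) (f g : BiDist A) : lin s (f + g) = lin s f + lin s g := by
  ext a b; simp only [lin, Pi.add_apply, mul_add]; abel

theorem lin_neg (s : A) (f : BiDist A) : lin s (-f) = -lin s f := by
  ext a b; simp only [lin, Pi.neg_apply, mul_neg]; abel

theorem lin_sub (s : A) (f g : BiDist A) : lin s (f - g) = lin s f - lin s g := by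
  rw [sub_eq_add_neg, lin_add, lin_neg, sub_eq_add_neg]

theorem lin_smul {s r : A} (h : Commute s r) (f : BiDist A) : lin s (r • f) = r • lin s f := by
  ext a b
  simp only [lin, Pi.smul_apply, smul_eq_mul, mul_add, mul_sub, ← mul_assoc, h.eq]

theorem lin_comm {s r : A} (h : Commute s r) (f : BiDist A) :
    lin s (lin r f) = lin r (lin s f) := by
  ext a b
  simp only [lin, mul_add, mul_sub, ← mul_assoc, h.eq]
  abel

/-- The exchange of the two variables. -/
def transp (f : BiDist A) : BiDist A := fun a b => f b a

theorem transp_lin (s : A) (f : BiDist A) : transp (lin s f) = -lin (-s) (transp f) := by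
  ext a b; simp only [transp, lin, Pi.neg_apply, neg_mul]; abel

/-- The central element `h` defines a Hausdorff topology. -/
structure IsSep (h : A) : Prop where
  comm : ∀ x, Commute h x
  eq_zero : ∀ x, (∀ N : ℕ, ∃ y, x = h ^ N * y) → x = 0

theorem IsSep.mul_pow {h : A} (H : IsSep h) (s : A) (N : ℕ) : (h * s) ^ N = h ^ N * s ^ N :=
  (H.comm s).mul_pow N

/-- Multiplication by `u - v + h s` is injective on series whose powers of `v` are bounded
on one side. -/
theorem eq_zero_of_lin_eq_zero {h : A} (H : IsSep h) (s : A) (τ : Sgn) (n : ℤ) {g : BiDist A}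
    (hb : ∀ a b, -(τ.val * b) < n → g a b = 0) (h0 : lin (h * s) g = 0) : g = 0 := by
  have h0' : ∀ a b, g (a - 1) b - g a (b - 1) + h * s * g a b = 0 := fun a b =>
    congrFun (congrFun h0 a) b
  have key : ∀ m : ℕ, ∀ a b, -(τ.val * b) < n + m → g a b = 0 := by
    intro m
    induction m with
    | zero => simpa using hb
    | succ m ih =>
      intro a b hab
      push_cast at hab
      cases τ
      · simp only [Sgn.val, one_mul] at ih hab
        have := h0' a (b + 1)
        rw [ih (a - 1) (b + 1) (by omega), ih a (b + 1) (by omega), add_sub_cancel_right] at this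
        simpa using this
      · simp only [Sgn.val, neg_one_mul, neg_neg] at ih hab
        have step : ∀ a, g a b = (h * -s) * g (a + 1) b := by
          intro a
          have := h0' (a + 1) b
          rw [ih (a + 1) (b - 1) (by omega), add_sub_cancel_right, sub_zero] at this
          rw [mul_neg, neg_mul]
          exact eq_neg_of_add_eq_zero_left this
        have pow : ∀ N : ℕ, g a b = (h * -s) ^ N * g (a + N) b := by
          intro N
          induction N with
          | zero => simp
          | succ N ihN =>
            rw [ihN, step, ← mul_assoc, ← pow_succ]
            push_cast
            rw [add_assoc]
        refine H.eq_zero _ fun N => ⟨(-s) ^ N * g (a + N) b, ?_⟩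
        rw [pow N, H.mul_pow, mul_assoc]
  ext a b
  exact key ((-(τ.val * b)) - n + 1).toNat a b (by have := Int.self_le_toNat ((-(τ.val * b)) - n + 1); omega)

/-- The powers of `u` are bounded from the side of the sign. -/
def SuppU (σ : Sgn) (g : BiDist A) : Prop := ∀ a b, 0 < σ.val * a → g a b = 0

/-- The powers of `v` are bounded from the side of the sign. -/
def SuppV (τ : Sgn) (g : BiDist A) : Prop := ∀ a b, 0 < τ.val * b → g a b = 0

theorem SuppU.lin {σ : Sgn} {n : ℤ} {g : BiDist A} (s : A)
    (hg : ∀ a b, n < σ.val * a → g a b = 0) (a b : ℤ) (h : n + 1 < σ.val * a) :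
    lin s g a b = 0 := by
  rw [YangianDouble.lin, hg a b (by omega), hg a (b - 1) (by omega), hg (a - 1) b]
  · simp
  · cases σ <;> simp only [Sgn.val] at h ⊢ <;> omega

theorem SuppV.lin {σ : Sgn} {n : ℤ} {g : BiDist A} (s : A)
    (hg : ∀ a b, n < σ.val * b → g a b = 0) (a b : ℤ) (h : n + 1 < σ.val * b) :
    lin s g a b = 0 := by
  rw [YangianDouble.lin, hg a b (by omega), hg (a - 1) b (by omega), hg a (b - 1)]
  · simp
  · cases σ <;> simp only [Sgn.val] at h ⊢ <;> omega

theorem eq_of_lin_eqV {h : A} (H : IsSep h) {s : A} {τ : Sgn} {f g : BiDist A} (n : ℤ)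
    (hf : ∀ a b, n < τ.val * b → f a b = 0) (hg : ∀ a b, n < τ.val * b → g a b = 0)
    (h0 : lin (h * s) f = lin (h * s) g) : f = g := by
  refine sub_eq_zero.1 (eq_zero_of_lin_eq_zero H s τ (-n) (fun a b hab => ?_) ?_)
  · simp [hf a b (by omega), hg a b (by omega)]
  · rw [lin_sub, h0, sub_self]

theorem eq_of_lin_eqU {h : A} (H : IsSep h) {s : A} {σ : Sgn} {f g : BiDist A} (n : ℤ)
    (hf : ∀ a b, n < σ.val * a → f a b = 0) (hg : ∀ a b, n < σ.val * a → g a b = 0)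
    (h0 : lin (h * s) f = lin (h * s) g) : f = g := by
  have := eq_of_lin_eqV H (s := -s) (τ := σ) (f := transp f) (g := transp g) n
    (fun a b hab => hf b a hab) (fun a b hab => hg b a hab) (by
      have := congrArg transp h0
      rw [transp_lin, transp_lin] at this
      rw [mul_neg]
      exact neg_injective this)
  exact congrArg transp this

/-- `p(u) X(v) q(u)`, where `p(u)` and `q(u)` are power series in `u^{∓1}`. -/
def sand (σ : Sgn) (p : A⟦X⟧) (X : Dist A) (q : A⟦X⟧) : BiDist A :=
  fun a b => ser σ (p * PowerSeries.C (X b) * q) a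

/-- The relation `R(x) T₁ S₂ = S₂ T₁ R(y)` with cleared denominators, where `x = u - v + x₀`,
`y = u - v + y₀`. -/
def BiRTT (σ τ : Sgn) (h x₀ y₀ : A) (T S : Matrix (Fin 2) (Fin 2) A⟦X⟧) : Prop :=
  ∀ i j k l,
    lin (y₀ + h) (lin x₀ (outer (ser σ (T i j)) (ser τ (S k l))) +
      h • outer (ser σ (T k j)) (ser τ (S i l))) =
    lin (x₀ + h) (lin y₀ (outerRev (ser σ (T i j)) (ser τ (S k l))) +
      h • outerRev (ser σ (T i l)) (ser τ (S k j)))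

/-- Gauss coordinates whose coefficients commute with `c`. -/
structure GaussSeries (c : A) (a b d q e f : A⟦X⟧) : Prop where
  comm : ∀ p ∈ ({a, b, d, q, e, f} : Set A⟦X⟧), ∀ n, Commute c (PowerSeries.coeff n p)
  ab : a * b = 1
  ba : b * a = 1
  dq : d * q = 1
  qd : q * d = 1

open BiLaurent

theorem isLeftRegular_lin {h : A} (H : IsSep h) (σ τ : Sgn) (s : A) :
    IsLeftRegular (u σ - v τ + cst (h * s) : BiLaurent A) := by
  intro F G hFG
  have h1 := congrArg (toBiDist σ τ) hFG
  simp only [toBiDist_lin] at h1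
  rw [← sub_eq_zero, ← lin_sub, ← toBiDist_sub] at h1
  have h2 := eq_zero_of_lin_eq_zero H s τ (F - G).order (fun a b hab => by
    rw [toBiDist, HahnSeries.coeff_eq_zero_of_lt_order hab, HahnSeries.coeff_zero]) h1
  apply sub_eq_zero.1
  apply toBiDist_injective σ τ
  rw [h2]
  rfl

variable {h c x₁ y₁ : A} {a b d q e f a' b' d' q' e' f' : A⟦X⟧} {σ τ : Sgn}

theorem BiRTT.gaussData (H : IsSep h)
    (R : BiRTT σ τ h (h * x₁) (h * y₁) (gaussMat a d e f) (gaussMat a' d' e' f'))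
    (hx : ∃ m : ℤ, x₁ = m * c) (hy : ∃ m : ℤ, y₁ = m * c) (GT : GaussSeries c a b d q e f)
    (GS : GaussSeries c a' b' d' q' e' f') :
    GaussData (u σ - v τ + cst (h * x₁)) (u σ - v τ + cst (h * y₁)) (cst h)
      (inclU a) (inclU b) (inclU d) (inclU q) (inclU e) (inclU f)
      (inclV a') (inclV b') (inclV d') (inclV q') (inclV e') (inclV f') := by
  have hxc : ∀ {z}, Commute c z → Commute x₁ z := fun hz => by
    obtain ⟨m, rfl⟩ := hx; exact hz.intCast_mul_left m
  have hyc : ∀ {z}, Commute c z → Commute y₁ z := fun hz => by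
    obtain ⟨m, rfl⟩ := hy; exact hz.intCast_mul_left m
  have hxy : Commute x₁ y₁ := by
    obtain ⟨m, rfl⟩ := hx; obtain ⟨n, rfl⟩ := hy
    exact ((Commute.refl c).intCast_mul_right n).intCast_mul_left m
  have huv : ∀ (s : A) (z : BiLaurent A), cst s * z = z * cst s →
      (u σ - v τ + cst s) * z = z * (u σ - v τ + cst s) := fun s z hz => by
    rw [add_mul, sub_mul, u_comm, v_comm, hz, mul_add, mul_sub]
  have hcst : ∀ (s r : A), Commute s r → cst s * cst r = cst r * cst s := fun s r hsr => by
    rw [← map_mul, hsr.eq, map_mul]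
  have hlin : ∀ (s r : A), Commute s r → (u σ - v τ + cst s) * (u σ - v τ + cst r) =
      (u σ - v τ + cst r) * (u σ - v τ + cst s) := fun s r hsr => huv s _ (by
    rw [mul_add, mul_sub, ← u_comm, ← v_comm, hcst s r hsr, add_mul, sub_mul])
  have hU : ∀ z ∈ ({a, b, d, q, e, f} : Set A⟦X⟧), ∀ s : A, (∀ r, Commute c r → Commute s r) →
      cst s * inclU z = inclU z * cst s := fun z hz s hs =>
    cst_inclU_comm fun n => hs _ (GT.comm z hz n)
  have hV : ∀ z ∈ ({a', b', d', q', e', f'} : Set A⟦X⟧), ∀ s : A,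
      (∀ r, Commute c r → Commute s r) → cst s * inclV z = inclV z * cst s := fun z hz s hs =>
    cst_inclV_comm fun n => hs _ (GS.comm z hz n)
  have hh : ∀ r, Commute c r → Commute h r := fun r _ => H.comm r
  have hhx : ∀ r, Commute c r → Commute (h * x₁) r := fun r hr => (H.comm r).mul_left (hxc hr)
  have hhy : ∀ r, Commute c r → Commute (h * y₁) r := fun r hr => (H.comm r).mul_left (hyc hr)
  have hhxy : Commute (h * x₁) (h * y₁) :=
    (((H.comm h).mul_left (H.comm x₁).symm).mul_right ((H.comm y₁).mul_left hxy))
  refine ⟨?_, ?_, ?_, ?_, ?_, ?_, ?_, ?_, ?_, ?_, ?_⟩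
  · intro s hs z hz
    simp only [Set.mem_insert_iff, Set.mem_singleton_iff] at hs hz
    rcases hz with rfl | rfl | rfl | hz
    · rcases hs with rfl | rfl | rfl
      · rfl
      · exact hlin _ _ hhxy.symm
      · exact (huv _ _ (hcst _ _ (H.comm _).symm)).symm
    · rcases hs with rfl | rfl | rfl
      · exact hlin _ _ hhxy
      · rfl
      · exact (huv _ _ (hcst _ _ (H.comm _).symm)).symm
    · rcases hs with rfl | rfl | rfl
      · exact huv _ _ (hcst _ _ (H.comm _).symm)
      · exact huv _ _ (hcst _ _ (H.comm _).symm)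
      · rfl
    · have hz' : ∀ s : A, (∀ r, Commute c r → Commute s r) → cst s * z = z * cst s := by
        intro s hs
        rcases hz with rfl | rfl | rfl | rfl | rfl | rfl | rfl | rfl | rfl | rfl | rfl | rfl
        iterate 6 exact hU _ (by simp) s hs
        iterate 6 exact hV _ (by simp) s hs
      rcases hs with rfl | rfl | rfl
      · exact huv _ _ (hz' _ hhx)
      · exact huv _ _ (hz' _ hhy)
      · exact hz' _ hh
  · intro i j k l
    simp only [← gaussMat_map]
    apply toBiDist_injective σ τ
    have R' := R i j k l
    have e1 : ∀ s : A, u σ - v τ + cst s + cst h = (u σ - v τ + cst (s + h) : BiLaurent A) :=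
      fun s => by rw [map_add, add_assoc]
    have e2 : ∀ F : BiLaurent A, toBiDist σ τ (cst h * F) = h • toBiDist σ τ F := fun F => by
      ext a b; rw [toBiDist_cst_mul]; rfl
    simpa only [e1, e2, toBiDist_lin, toBiDist_add, toBiDist_outer, toBiDist_outerRev] using R'
  · intro s hs
    have e1 : ∀ s : A, u σ - v τ + cst (h * s) + cst h = (u σ - v τ + cst (h * (s + 1)) : BiLaurent A) :=
      fun s => by rw [mul_add, mul_one, map_add, add_assoc]
    have e2 : ∀ s : A, u σ - v τ + cst (h * s) - cst h = (u σ - v τ + cst (h * (s - 1)) : BiLaurent A) :=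
      fun s => by rw [mul_sub, mul_one, map_sub, add_sub_assoc]
    simp only [e1, e2, Set.mem_insert_iff, Set.mem_singleton_iff] at hs
    rcases hs with rfl | rfl | rfl | rfl | rfl | rfl <;> exact isLeftRegular_lin H _ _ _
  iterate 4 rw [← map_mul, ← map_one inclU]; first | rw [GT.ab] | rw [GT.ba] | rw [GT.dq] | rw [GT.qd]
  iterate 4 rw [← map_mul, ← map_one inclV]; first | rw [GS.ab] | rw [GS.ba] | rw [GS.dq] | rw [GS.qd]

end Series

end YangianDouble

end

noncomputable section

namespace YangianDouble

section Series

variable {A : Type*} [Ring A] {h c x₁ y₁ : A} {a b d q e f a' b' d' q' e' f' : A⟦X⟧} {σ τ : Sgn}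

open BiLaurent

theorem transp_smul (s : A) (f : BiDist A) : transp (s • f) = s • transp f := rfl

theorem transp_sub (f g : BiDist A) : transp (f - g) = transp f - transp g := rfl

theorem transp_outer (f g : Dist A) : transp (outer f g) = outerRev g f := rfl

theorem transp_outerRev (f g : Dist A) : transp (outerRev f g) = outer g f := rfl

theorem BiRTT.transp (H : IsSep h)
    (R : BiRTT σ τ h (h * x₁) (h * y₁) (gaussMat a d e f) (gaussMat a' d' e' f'))
    (hx : ∃ m : ℤ, x₁ = m * c) (hy : ∃ m : ℤ, y₁ = m * c) (GT : GaussSeries c a b d q e f)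
    (GS : GaussSeries c a' b' d' q' e' f') :
    BiRTT τ σ h (-(h * x₁)) (-(h * y₁)) (gaussMat a' d' e' f') (gaussMat a d e f) := by
  intro i j k l
  have G := (R.gaussData H hx hy GT GS).swap_rtt i j k l
  simp only [← gaussMat_map] at G
  have e1 : ∀ s : A, u σ - v τ + cst s - cst h = (u σ - v τ + cst (s - h) : BiLaurent A) :=
    fun s => by rw [map_sub, add_sub_assoc]
  have e2 : ∀ F : BiLaurent A, toBiDist σ τ (cst h * F) = h • toBiDist σ τ F := fun F => by
    ext a b; rw [toBiDist_cst_mul]; rfl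
  have G' := congrArg (toBiDist σ τ) G
  simp only [e1, e2, toBiDist_lin, toBiDist_sub, toBiDist_outer, toBiDist_outerRev] at G'
  have G' := congrArg YangianDouble.transp G'
  have n : ∀ s : A, -(s - h) = -s + h := fun s => by abel
  simp only [transp_lin, transp_sub, transp_smul, transp_outer, transp_outerRev, n, neg_inj] at G'
  have m : ∀ s (f g : BiDist A), -lin s f - g = -(lin s f + g) := fun s f g => by abel
  simpa only [m, lin_neg, neg_inj] using G'

theorem BiRTT.relations (H : IsSep h)
    (R : BiRTT σ τ h (h * x₁) (h * y₁) (gaussMat a d e f) (gaussMat a' d' e' f'))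
    (hx : ∃ m : ℤ, x₁ = m * c) (hy : ∃ m : ℤ, y₁ = m * c) (GT : GaussSeries c a b d q e f)
    (GS : GaussSeries c a' b' d' q' e' f') :
    outer (ser σ a) (ser τ a') = outerRev (ser σ a) (ser τ a') ∧
    outer (ser σ d) (ser τ d') = outerRev (ser σ d) (ser τ d') ∧
    lin (h * y₁ + h) (lin (h * x₁) (outerRev (ser σ a) (ser τ q'))) =
      lin (h * x₁ + h) (lin (h * y₁) (outer (ser σ a) (ser τ q'))) ∧
    lin (h * y₁) (sand σ b (ser τ e') a) =
      lin (h * y₁ + h) (inV (ser τ e')) - h • inU (ser σ e) ∧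
    lin (h * x₁) (sand σ a (ser τ f') b) =
      lin (h * x₁ + h) (inV (ser τ f')) - h • inU (ser σ f) ∧
    lin (h * y₁) (sand σ q (ser τ e') d) =
      lin (h * y₁ - h) (inV (ser τ e')) + h • inU (ser σ e) ∧
    lin (h * x₁) (sand σ d (ser τ f') q) =
      lin (h * x₁ - h) (inV (ser τ f')) + h • inU (ser σ f) ∧
    lin (h * y₁ - h) (outer (ser σ e) (ser τ e')) -
        lin (h * y₁ + h) (outerRev (ser σ e) (ser τ e')) =
      -(h • (inU (ser σ (e * e)) + inV (ser τ (e' * e')))) ∧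
    lin (h * x₁ + h) (outer (ser σ f) (ser τ f')) -
        lin (h * x₁ - h) (outerRev (ser σ f) (ser τ f')) =
      h • (inU (ser σ (f * f)) + inV (ser τ (f' * f'))) ∧
    (d * a = a * d →
      lin (h * x₁) (lin (h * y₁) (outer (ser σ e) (ser τ f') - outerRev (ser σ e) (ser τ f'))) =
        h • (lin (h * x₁) (inV (ser τ (d' * b'))) - lin (h * y₁) (inU (ser σ (d * b))))) := by
  obtain ⟨r1, r2, r3, r4, r5, r6, r7, r8, r9, r10⟩ := (R.gaussData H hx hy GT GS).relations
  have e1 : ∀ s : A, u σ - v τ + cst s + cst h = (u σ - v τ + cst (s + h) : BiLaurent A) :=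
    fun s => by rw [map_add, add_assoc]
  have e1' : ∀ s : A, u σ - v τ + cst s - cst h = (u σ - v τ + cst (s - h) : BiLaurent A) :=
    fun s => by rw [map_sub, add_sub_assoc]
  have e2 : ∀ F : BiLaurent A, toBiDist σ τ (cst h * F) = h • toBiDist σ τ F := fun F => by
    ext a b; rw [toBiDist_cst_mul]; rfl
  have e3 : ∀ p q r : A⟦X⟧, toBiDist σ τ (inclU p * inclV q * inclU r) = sand σ p (ser τ q) r :=
    fun p q r => by ext a b; exact toBiDist_sandwich σ τ p q r a b
  have mk : ∀ {F G : BiLaurent A}, F = G → toBiDist σ τ F = toBiDist σ τ G := fun h => by rw [h]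
  refine ⟨?_, ?_, ?_, ?_, ?_, ?_, ?_, ?_, ?_, ?_⟩
  · simpa only [toBiDist_outer, toBiDist_outerRev] using mk r1
  · simpa only [toBiDist_outer, toBiDist_outerRev] using mk r2
  · simpa only [e1, toBiDist_lin, toBiDist_outer, toBiDist_outerRev] using mk r3
  · simpa only [e1, e1', e2, e3, toBiDist_lin, toBiDist_sub, toBiDist_inclU, toBiDist_inclV]
      using mk r4
  · simpa only [e1, e1', e2, e3, toBiDist_lin, toBiDist_sub, toBiDist_inclU, toBiDist_inclV]
      using mk r5
  · simpa only [e1, e1', e2, e3, toBiDist_lin, toBiDist_add, toBiDist_inclU, toBiDist_inclV]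
      using mk r6
  · simpa only [e1, e1', e2, e3, toBiDist_lin, toBiDist_add, toBiDist_inclU, toBiDist_inclV]
      using mk r7
  · simpa only [e1, e1', e2, toBiDist_lin, toBiDist_add, toBiDist_sub, toBiDist_neg, ← map_mul,
      toBiDist_outer, toBiDist_outerRev, toBiDist_inclU, toBiDist_inclV] using mk r8
  · simpa only [e1, e1', e2, toBiDist_lin, toBiDist_add, toBiDist_sub, ← map_mul,
      toBiDist_outer, toBiDist_outerRev, toBiDist_inclU, toBiDist_inclV] using mk r9
  · intro hd
    have r := r10 (by rw [← map_mul, hd, map_mul])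
    simp only [← map_mul inclU d b, ← map_mul inclV d' b'] at r
    simpa only [e2, toBiDist_lin, toBiDist_sub, toBiDist_outer, toBiDist_outerRev,
      toBiDist_inclU, toBiDist_inclV] using mk r

end Series

end YangianDouble

end

noncomputable section

namespace YangianDouble

/-- A closed ideal which contains the defining relations. -/
structure IsRelIdeal (J : TwoSidedIdeal FreeDY) : Prop where
  rel : ∀ x, FreeDY.Rel x → x ∈ J
  closed : IsClosedIdeal J

theorem isRelIdeal_relIdeal : IsRelIdeal relIdeal where
  rel x hx := (TwoSidedIdeal.mem_sInf _).2 fun _ hI => hI.1 x hx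
  closed x hx := (TwoSidedIdeal.mem_sInf _).2 fun I hI => hI.2 x fun N => by
    obtain ⟨y, hy⟩ := hx N
    exact ⟨y, (TwoSidedIdeal.mem_sInf _).1 hy I hI⟩

theorem isRelIdeal_relIdealTF : IsRelIdeal relIdealTF where
  rel x hx := (TwoSidedIdeal.mem_sInf _).2 fun _ hI => hI.1 x hx
  closed x hx := (TwoSidedIdeal.mem_sInf _).2 fun I hI => hI.2.1 x fun N => by
    obtain ⟨y, hy⟩ := hx N
    exact ⟨y, (TwoSidedIdeal.mem_sInf _).1 hy I hI⟩

section Quotient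

variable {J : TwoSidedIdeal FreeDY}

theorem proj_surjective : Function.Surjective (proj J) := J.ringCon.mk'_surjective

theorem proj_eq_zero {x : FreeDY} : proj J x = 0 ↔ x ∈ J := by
  rw [← map_zero (proj J)]
  refine (RingCon.eq _).trans ?_
  rw [TwoSidedIdeal.rel_iff, sub_zero]

theorem IsRelIdeal.isSep (hJ : IsRelIdeal J) : IsSep (hbar J) where
  comm x := by
    obtain ⟨x, rfl⟩ := proj_surjective x
    exact (PowerSeries.commute_X x).symm.map (proj J)
  eq_zero x hx := by
    obtain ⟨x, rfl⟩ := proj_surjective x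
    refine proj_eq_zero.2 (hJ.closed x fun N => ?_)
    obtain ⟨y, hy⟩ := hx N
    obtain ⟨y, rfl⟩ := proj_surjective y
    exact ⟨y, proj_eq_zero.1 (by rw [map_sub, hy, map_mul, map_pow]; exact sub_self _)⟩

theorem isUnit_one_add_hbar_mul (y : DY J) : IsUnit (1 + hbar J * y) := by
  obtain ⟨y, rfl⟩ := proj_surjective y
  have : IsUnit (1 + FreeDY.h * y) := by
    rw [PowerSeries.isUnit_iff_constantCoeff]
    simp [FreeDY.h]
  simpa [hbar] using this.map (proj J)

theorem constantCoeff_T (σ : Sgn) (i j : Fin 2) :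
    ∃ y : DY J, PowerSeries.constantCoeff (T J σ i j) = (if i = j then 1 else 0) + hbar J * y := by
  cases σ
  · exact ⟨0, by simp [T, FreeDY.T, ← PowerSeries.coeff_zero_eq_constantCoeff_apply]⟩
  · exact ⟨proj J (FreeDY.t i j (-1)), by
      simp [T, FreeDY.T, ← PowerSeries.coeff_zero_eq_constantCoeff_apply, hbar]⟩

theorem isUnit_k1 (σ : Sgn) : IsUnit (k1 J σ) := by
  obtain ⟨y, hy⟩ := constantCoeff_T (J := J) σ 0 0
  rw [PowerSeries.isUnit_iff_constantCoeff, k1, hy]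
  simpa using isUnit_one_add_hbar_mul y

theorem isUnit_k2 (σ : Sgn) : IsUnit (k2 J σ) := by
  obtain ⟨y, hy⟩ := constantCoeff_T (J := J) σ 1 1
  obtain ⟨z, hz⟩ := constantCoeff_T (J := J) σ 1 0
  rw [PowerSeries.isUnit_iff_constantCoeff, k2, map_sub, map_mul, map_mul, hy, hz]
  simpa [add_sub_assoc, mul_sub, mul_assoc] using isUnit_one_add_hbar_mul
    (y - z * PowerSeries.constantCoeff (Ring.inverse (T J σ 0 0)) *
      PowerSeries.constantCoeff (T J σ 0 1))

theorem isUnit_k (i : Fin 2) (σ : Sgn) : IsUnit (k J i σ) := by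
  unfold k
  split_ifs
  exacts [isUnit_k1 σ, isUnit_k2 σ]

/-- The coefficients of a power series commute with `c`. -/
def CommC (p : (DY J)⟦X⟧) : Prop := ∀ n, Commute (c4 J) (PowerSeries.coeff n p)

theorem commC_iff {p : (DY J)⟦X⟧} : CommC p ↔ Commute (PowerSeries.C (c4 J)) p := by
  constructor
  · exact fun h => C_mul_comm h
  · intro h n
    have := congrArg (PowerSeries.coeff n) h.eq
    rwa [PowerSeries.coeff_C_mul, PowerSeries.coeff_mul_C] at this

theorem IsRelIdeal.commC_T (hJ : IsRelIdeal J) (σ : Sgn) (i j : Fin 2) : CommC (T J σ i j) := by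
  intro n
  have h1 := proj_eq_zero.2 (hJ.rel _ (FreeDY.Rel.central σ i j n))
  have h2 : (1 / 4 : ℂ) • FreeDY.c = algebraMap ℂ FreeDY (1 / 4) * FreeDY.c :=
    Algebra.smul_def _ _
  rw [map_sub, sub_eq_zero, map_mul, map_mul] at h1
  have h3 : Commute (proj J FreeDY.c) (PowerSeries.coeff n (T J σ i j)) := by
    rw [T, PowerSeries.coeff_map]
    exact h1.symm
  rw [c4, h2, map_mul]
  refine Commute.mul_left ?_ h3
  obtain ⟨x, hx⟩ := proj_surjective (PowerSeries.coeff n (T J σ i j))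
  rw [← hx]
  exact (show Commute _ x from Algebra.commutes (1 / 4 : ℂ) x).map (proj J)

theorem CommC.mul {p q : (DY J)⟦X⟧} (hp : CommC p) (hq : CommC q) : CommC (p * q) :=
  commC_iff.2 ((commC_iff.1 hp).mul_right (commC_iff.1 hq))

theorem CommC.sub {p q : (DY J)⟦X⟧} (hp : CommC p) (hq : CommC q) : CommC (p - q) :=
  commC_iff.2 ((commC_iff.1 hp).sub_right (commC_iff.1 hq))

theorem CommC.inverse {p : (DY J)⟦X⟧} (hp : CommC p) : CommC (Ring.inverse p) := by
  by_cases h : IsUnit p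
  · obtain ⟨p, rfl⟩ := h
    rw [Ring.inverse_unit]
    exact commC_iff.2 (commC_iff.1 hp).units_inv_right
  · rw [Ring.inverse_non_unit _ h]
    exact commC_iff.2 (Commute.zero_right _)

theorem IsRelIdeal.commC_k1 (hJ : IsRelIdeal J) (σ : Sgn) : CommC (k1 J σ) := hJ.commC_T σ 0 0

theorem IsRelIdeal.commC_e (hJ : IsRelIdeal J) (σ : Sgn) : CommC (e J σ) :=
  (hJ.commC_T σ 0 0).inverse.mul (hJ.commC_T σ 0 1)

theorem IsRelIdeal.commC_f (hJ : IsRelIdeal J) (σ : Sgn) : CommC (f J σ) :=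
  (hJ.commC_T σ 1 0).mul (hJ.commC_T σ 0 0).inverse

theorem IsRelIdeal.commC_k2 (hJ : IsRelIdeal J) (σ : Sgn) : CommC (k2 J σ) :=
  (hJ.commC_T σ 1 1).sub (((hJ.commC_T σ 1 0).mul (hJ.commC_T σ 0 0).inverse).mul
    (hJ.commC_T σ 0 1))

theorem IsRelIdeal.gaussSeries (hJ : IsRelIdeal J) (σ : Sgn) :
    GaussSeries (c4 J) (k1 J σ) (Ring.inverse (k1 J σ)) (k2 J σ) (Ring.inverse (k2 J σ))
      (e J σ) (f J σ) where
  comm p hp := by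
    simp only [Set.mem_insert_iff, Set.mem_singleton_iff] at hp
    rcases hp with rfl | rfl | rfl | rfl | rfl | rfl
    exacts [hJ.commC_k1 σ, (hJ.commC_k1 σ).inverse, hJ.commC_k2 σ, (hJ.commC_k2 σ).inverse,
      hJ.commC_e σ, hJ.commC_f σ]
  ab := Ring.mul_inverse_cancel _ (isUnit_k1 σ)
  ba := Ring.inverse_mul_cancel _ (isUnit_k1 σ)
  dq := Ring.mul_inverse_cancel _ (isUnit_k2 σ)
  qd := Ring.inverse_mul_cancel _ (isUnit_k2 σ)

theorem gaussMat_eq (σ : Sgn) (i j : Fin 2) :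
    gaussMat (k1 J σ) (k2 J σ) (e J σ) (f J σ) i j = T J σ i j := by
  have h1 : T J σ 0 0 * Ring.inverse (T J σ 0 0) = 1 := Ring.mul_inverse_cancel _ (isUnit_k1 σ)
  have h2 : Ring.inverse (T J σ 0 0) * T J σ 0 0 = 1 := Ring.inverse_mul_cancel _ (isUnit_k1 σ)
  have h3 : f J σ * k1 J σ = T J σ 1 0 := by rw [f, k1, mul_assoc, h2, mul_one]
  fin_cases i <;> fin_cases j
  · rfl
  · simp only [gaussMat, e, k1]
    change T J σ 0 0 * (Ring.inverse (T J σ 0 0) * T J σ 0 1) = _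
    rw [← mul_assoc, h1, one_mul]
    rfl
  · exact h3
  · change k2 J σ + f J σ * k1 J σ * e J σ = T J σ 1 1
    rw [h3, k2, e, mul_assoc, sub_add_cancel]

theorem proj_ser (σ : Sgn) (i j : Fin 2) (a : ℤ) :
    proj J (ser σ (FreeDY.T σ i j) a) = ser σ (T J σ i j) a := by
  cases σ <;> simp only [ser, T] <;> split_ifs <;> simp

theorem proj_hc2 : proj J FreeDY.hc2 = hbar J * (c4 J + c4 J) := by
  rw [FreeDY.hc2, map_mul, c4, ← map_add, ← add_smul]
  norm_num [hbar]

theorem IsRelIdeal.biRTT (hJ : IsRelIdeal J) (σ τ : Sgn) :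
    BiRTT σ τ (hbar J) (hbar J * (pm J τ - pm J σ)) (hbar J * (pm J σ - pm J τ))
      (gaussMat (k1 J σ) (k2 J σ) (e J σ) (f J σ)) (gaussMat (k1 J τ) (k2 J τ) (e J τ) (f J τ)) := by
  have same : ∀ σ, BiRTT σ σ (hbar J) (hbar J * (pm J σ - pm J σ)) (hbar J * (pm J σ - pm J σ))
      (gaussMat (k1 J σ) (k2 J σ) (e J σ) (f J σ))
      (gaussMat (k1 J σ) (k2 J σ) (e J σ) (f J σ)) := by
    intro σ i j k l
    simp only [gaussMat_eq, sub_self, mul_zero]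
    congr 1
    ext a b
    have := proj_eq_zero.2 (hJ.rel _ (FreeDY.Rel.same σ (i, k) (j, l) a b))
    simpa [FreeDY.yangL, FreeDY.yangR, FreeDY.TT, FreeDY.TTrev, lin, outer, outerRev, proj_ser,
      sub_eq_zero, hbar] using this
  have mixed : BiRTT .pos .neg (hbar J) (hbar J * (pm J .neg - pm J .pos))
      (hbar J * (pm J .pos - pm J .neg))
      (gaussMat (k1 J .pos) (k2 J .pos) (e J .pos) (f J .pos))
      (gaussMat (k1 J .neg) (k2 J .neg) (e J .neg) (f J .neg)) := by
    intro i j k l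
    simp only [gaussMat_eq]
    have hp : hbar J * (pm J .pos - pm J .neg) = proj J FreeDY.hc2 := by
      rw [proj_hc2]; simp [pm, Sgn.val]
    have hn : hbar J * (pm J .neg - pm J .pos) = -proj J FreeDY.hc2 := by
      rw [← hp, ← mul_neg, neg_sub]
    rw [hp, hn]
    ext a b
    have := proj_eq_zero.2 (hJ.rel _ (FreeDY.Rel.mixed (i, k) (j, l) a b))
    rw [map_sub, sub_eq_zero] at this
    simpa [FreeDY.linMat, FreeDY.yangL, FreeDY.yangR, FreeDY.TT, FreeDY.TTrev, lin, outer,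
      outerRev, proj_ser, hbar] using this
  have hc : ∀ σ τ : Sgn, ∃ m : ℤ, pm J σ - pm J τ = m * c4 J := fun σ τ =>
    ⟨σ.val - τ.val, by rw [pm, pm, ← sub_mul, Int.cast_sub]⟩
  cases σ <;> cases τ
  · exact same _
  · exact mixed
  · have := mixed.transp hJ.isSep (hc _ _) (hc _ _) (hJ.gaussSeries _) (hJ.gaussSeries _)
    rwa [← mul_neg, ← mul_neg, neg_sub, neg_sub] at this
  · exact same _

end Quotient

end YangianDouble

end

noncomputable section

namespace YangianDouble

section Shift

variable {J : TwoSidedIdeal FreeDY}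

theorem hbar_comm (x : DY J) : Commute (hbar J) x := by
  obtain ⟨x, rfl⟩ := proj_surjective x
  exact (PowerSeries.commute_X x).symm.map (proj J)

theorem hbar_pow_comm (n : ℕ) (x : DY J) : Commute (hbar J ^ n) x := (hbar_comm x).pow_left n

theorem hsum_spec (x : ℕ → DY J) (N : ℕ) :
    hbar J ^ N ∣ hsum J x - ∑ n ∈ Finset.range N, hbar J ^ n * x n :=
  (exists_hsum J x).choose_spec N

theorem eq_of_dvd (H : IsSep (hbar J)) {x y : DY J} (h : ∀ N, hbar J ^ N ∣ x - y) : x = y :=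
  sub_eq_zero.1 (H.eq_zero _ h)

theorem hsum_unique (H : IsSep (hbar J)) {x : ℕ → DY J} {s : DY J}
    (h : ∀ N, hbar J ^ N ∣ s - ∑ n ∈ Finset.range N, hbar J ^ n * x n) : hsum J x = s :=
  eq_of_dvd H fun N => by
    have := dvd_sub (hsum_spec x N) (h N)
    rwa [sub_sub_sub_cancel_right] at this

theorem hsum_add (H : IsSep (hbar J)) (x y : ℕ → DY J) :
    hsum J (fun n => x n + y n) = hsum J x + hsum J y :=
  hsum_unique H fun N => by
    have := dvd_add (hsum_spec x N) (hsum_spec y N)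
    rwa [← add_sub_add_comm, ← Finset.sum_add_distrib, Finset.sum_congr rfl
      fun n _ => (mul_add (hbar J ^ n) (x n) (y n)).symm] at this

theorem hsum_mul_left (H : IsSep (hbar J)) (b : DY J) (x : ℕ → DY J) :
    hsum J (fun n => b * x n) = b * hsum J x :=
  hsum_unique H fun N => by
    obtain ⟨y, hy⟩ := hsum_spec x N
    refine ⟨b * y, ?_⟩
    rw [← mul_assoc, (hbar_pow_comm N b).eq, mul_assoc, ← hy, mul_sub, Finset.mul_sum]
    congr 1
    refine Finset.sum_congr rfl fun n _ => ?_
    rw [← mul_assoc, (hbar_pow_comm n b).eq, mul_assoc]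

theorem hsum_mul_right (H : IsSep (hbar J)) (b : DY J) (x : ℕ → DY J) :
    hsum J (fun n => x n * b) = hsum J x * b :=
  hsum_unique H fun N => by
    obtain ⟨y, hy⟩ := hsum_spec x N
    refine ⟨y * b, ?_⟩
    rw [← mul_assoc, ← hy, sub_mul, Finset.sum_mul]
    simp only [mul_assoc]

theorem hsum_succ (H : IsSep (hbar J)) (x : ℕ → DY J) :
    hsum J x = x 0 + hbar J * hsum J (fun n => x (n + 1)) :=
  hsum_unique H fun N => by
    rcases N with _ | N
    · simp
    · obtain ⟨y, hy⟩ := hsum_spec (fun n => x (n + 1)) N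
      refine ⟨y, ?_⟩
      rw [Finset.sum_range_succ', pow_succ', mul_assoc, ← hy, mul_sub, Finset.mul_sum]
      simp only [pow_succ', mul_assoc, pow_zero, one_mul]
      abel

theorem hsum_eq_zero (H : IsSep (hbar J)) {x : ℕ → DY J} (h : ∀ n, x n = 0) : hsum J x = 0 :=
  hsum_unique H fun N => by simp [h]

theorem dvd_hsum {x : ℕ → DY J} {N : ℕ} (h : ∀ n < N, hbar J ^ N ∣ hbar J ^ n * x n) :
    hbar J ^ N ∣ hsum J x := by
  have := dvd_add (hsum_spec x N) (Finset.dvd_sum fun n hn => h n (Finset.mem_range.1 hn))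
  rwa [sub_add_cancel] at this

theorem shift_add (H : IsSep (hbar J)) (s : DY J) (f g : Dist (DY J)) :
    shift J s (f + g) = shift J s f + shift J s g := by
  ext a
  simp only [shift, Pi.add_apply, mul_add, smul_add]
  exact hsum_add H _ _

theorem shift_mul_left (H : IsSep (hbar J)) {s b : DY J} (hsb : Commute s b) (f : Dist (DY J))
    (a : ℤ) : shift J s (fun a => b * f a) a = b * shift J s f a := by
  simp only [shift]
  rw [← hsum_mul_left H]
  congr 1
  ext n
  rw [mul_smul_comm, ← mul_assoc, ← mul_assoc, (hsb.pow_left n).eq]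

theorem shift_mul_right (H : IsSep (hbar J)) (s b : DY J) (f : Dist (DY J))
    (a : ℤ) : shift J s (fun a => f a * b) a = shift J s f a * b := by
  simp only [shift]
  rw [← hsum_mul_right H]
  congr 1
  ext n
  rw [smul_mul_assoc, mul_assoc]

/-- The substitution `u ↦ u + ħ s` as an additive map. -/
def shiftHom (H : IsSep (hbar J)) (s : DY J) : Dist (DY J) →+ Dist (DY J) :=
  AddMonoidHom.mk' (shift J s) (shift_add H s)

theorem shift_neg (H : IsSep (hbar J)) (s : DY J) (f : Dist (DY J)) :
    shift J s (-f) = -shift J s f := map_neg (shiftHom H s) f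

theorem shift_sub (H : IsSep (hbar J)) (s : DY J) (f g : Dist (DY J)) :
    shift J s (f - g) = shift J s f - shift J s g := map_sub (shiftHom H s) f g

theorem shift_zero (H : IsSep (hbar J)) (s : DY J) : shift J s 0 = 0 := map_zero (shiftHom H s)

theorem shift_sum (H : IsSep (hbar J)) (s : DY J) {ι : Type*} (S : Finset ι)
    (f : ι → Dist (DY J)) : shift J s (∑ i ∈ S, f i) = ∑ i ∈ S, shift J s (f i) :=
  map_sum (shiftHom H s) f S

/-- The substitution applied to `u f(u)`. -/
theorem shift_mul_var (H : IsSep (hbar J)) (s : DY J) (f : Dist (DY J)) (a : ℤ) :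
    shift J s (fun a => f (a - 1)) a = shift J s f (a - 1) + hbar J * s * shift J s f a := by
  let y : ℕ → DY J := fun n => match n with
    | 0 => 0
    | n + 1 => Ring.choose (a + (n : ℤ)) n • (s ^ (n + 1) * f (a + n))
  have hy : hsum J y = hbar J * s * shift J s f a := by
    rw [hsum_succ H, shift, mul_assoc, ← hsum_mul_left H s]
    simp only [y, zero_add]
    congr 2
    ext n
    rw [mul_smul_comm, ← mul_assoc, ← pow_succ']
  rw [← hy, shift, shift, ← hsum_add H]
  congr 1
  ext n
  rcases n with _ | n
  · simp [y]
  · simp only [y]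
    have e1 : a + ((n + 1 : ℕ) : ℤ) = a + n + 1 := by push_cast; ring
    have e2 : a - 1 + ((n + 1 : ℕ) : ℤ) = a + n := by push_cast; ring
    rw [e1, e2, Ring.choose_succ_succ, add_sub_cancel_right, add_smul, add_comm]

theorem shift_delta (H : IsSep (hbar J)) (s z : DY J) :
    shift J s (fun a => if a = 0 then z else 0) = fun a => if a = 0 then z else 0 := by
  ext a
  rw [shift, hsum_succ H, hsum_eq_zero H]
  · simp
  · intro n
    split_ifs with h
    · rw [h, Ring.choose_zero_succ, zero_smul]
    · simp

theorem shift_support (H : IsSep (hbar J)) (s : DY J) {σ : Sgn} {f : Dist (DY J)}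
    (hf : ∀ a, 0 < σ.val * a → f a = 0) (a : ℤ) (ha : 0 < σ.val * a) : shift J s f a = 0 := by
  apply hsum_eq_zero H
  intro n
  cases σ
  · simp only [Sgn.val, one_mul] at hf ha
    rw [hf _ (by omega), mul_zero, smul_zero]
  · simp only [Sgn.val, neg_one_mul, Left.neg_pos_iff] at hf ha
    rcases lt_or_ge (a + n) 0 with h | h
    · rw [hf _ h, mul_zero, smul_zero]
    · obtain ⟨m, hm⟩ := Int.eq_ofNat_of_zero_le h
      rw [hm, Ring.choose_natCast, Nat.choose_eq_zero_of_lt (by omega)]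
      simp

theorem shiftU_add (H : IsSep (hbar J)) (s : DY J) (f g : BiDist (DY J)) :
    shiftU J s (f + g) = shiftU J s f + shiftU J s g := by
  ext a b
  exact congrFun (shift_add H s (fun a => f a b) (fun a => g a b)) a

theorem shiftV_add (H : IsSep (hbar J)) (s : DY J) (f g : BiDist (DY J)) :
    shiftV J s (f + g) = shiftV J s f + shiftV J s g := by
  ext a b
  exact congrFun (shift_add H s (f a) (g a)) b

theorem shiftU_neg (H : IsSep (hbar J)) (s : DY J) (f : BiDist (DY J)) :
    shiftU J s (-f) = -shiftU J s f := by
  ext a b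
  exact congrFun (shift_neg H s (fun a => f a b)) a

theorem shiftV_neg (H : IsSep (hbar J)) (s : DY J) (f : BiDist (DY J)) :
    shiftV J s (-f) = -shiftV J s f := by
  ext a b
  exact congrFun (shift_neg H s (f a)) b

theorem shiftU_sub (H : IsSep (hbar J)) (s : DY J) (f g : BiDist (DY J)) :
    shiftU J s (f - g) = shiftU J s f - shiftU J s g := by
  rw [sub_eq_add_neg, shiftU_add H, shiftU_neg H, sub_eq_add_neg]

theorem shiftV_sub (H : IsSep (hbar J)) (s : DY J) (f g : BiDist (DY J)) :
    shiftV J s (f - g) = shiftV J s f - shiftV J s g := by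
  rw [sub_eq_add_neg, shiftV_add H, shiftV_neg H, sub_eq_add_neg]

theorem shiftU_smul (H : IsSep (hbar J)) {s r : DY J} (h : Commute s r) (f : BiDist (DY J)) :
    shiftU J s (r • f) = r • shiftU J s f := by
  ext a b
  exact shift_mul_left H h (fun a => f a b) a

theorem shiftV_smul (H : IsSep (hbar J)) {s r : DY J} (h : Commute s r) (f : BiDist (DY J)) :
    shiftV J s (r • f) = r • shiftV J s f := by
  ext a b
  exact shift_mul_left H h (f a) b

theorem shiftU_lin (H : IsSep (hbar J)) {s r : DY J} (h : Commute s r) (g : BiDist (DY J)) :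
    shiftU J s (lin r g) = lin (r + hbar J * s) (shiftU J s g) := by
  ext a b
  have e : (fun a' => lin r g a' b) = (fun a' => g (a' - 1) b) - (fun a' => g a' (b - 1)) +
      (fun a' => r * g a' b) := rfl
  rw [shiftU, e, shift_add H, shift_sub H, Pi.add_apply, Pi.sub_apply, shift_mul_left H h,
    shift_mul_var H s (fun a' => g a' b)]
  simp only [lin, shiftU, add_mul]
  abel

theorem shiftV_lin (H : IsSep (hbar J)) {s r : DY J} (h : Commute s r) (g : BiDist (DY J)) :
    shiftV J s (lin r g) = lin (r - hbar J * s) (shiftV J s g) := by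
  ext a b
  have e : lin r g a = (fun b' => g (a - 1) b') - (fun b' => g a (b' - 1)) +
      (fun b' => r * g a b') := rfl
  rw [shiftV, e, shift_add H, shift_sub H, Pi.add_apply, Pi.sub_apply, shift_mul_left H h,
    shift_mul_var H s (g a)]
  simp only [lin, shiftV, sub_mul]
  abel

theorem shiftU_outer (H : IsSep (hbar J)) (s : DY J) (f g : Dist (DY J)) :
    shiftU J s (outer f g) = outer (shift J s f) g := by
  ext a b
  exact shift_mul_right H s (g b) f a

theorem shiftU_outerRev (H : IsSep (hbar J)) {s : DY J} (f : Dist (DY J)) {g : Dist (DY J)}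
    (h : ∀ b, Commute s (g b)) : shiftU J s (outerRev f g) = outerRev (shift J s f) g := by
  ext a b
  exact shift_mul_left H (h b) f a

theorem shiftV_outer (H : IsSep (hbar J)) {s : DY J} {f : Dist (DY J)} (g : Dist (DY J))
    (h : ∀ a, Commute s (f a)) : shiftV J s (outer f g) = outer f (shift J s g) := by
  ext a b
  exact shift_mul_left H (h a) g b

theorem shiftV_outerRev (H : IsSep (hbar J)) (s : DY J) (f g : Dist (DY J)) :
    shiftV J s (outerRev f g) = outerRev f (shift J s g) := by
  ext a b
  exact shift_mul_right H s (f a) g b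

theorem shiftU_inU (H : IsSep (hbar J)) (s : DY J) (f : Dist (DY J)) :
    shiftU J s (inU f) = inU (shift J s f) := by
  ext a b
  simp only [shiftU, inU]
  split_ifs
  · rfl
  · exact congrFun (shift_zero H s) a

theorem shiftV_inV (H : IsSep (hbar J)) (s : DY J) (f : Dist (DY J)) :
    shiftV J s (inV f) = inV (shift J s f) := by
  ext a b
  simp only [shiftV]
  by_cases h : a = 0
  · subst h
    simp only [inV, if_true]
    rfl
  · have : inV f a = 0 := by ext; simp [inV, h]
    rw [this, shift_zero H]
    simp [inV, h]

theorem shiftU_inV (H : IsSep (hbar J)) (s : DY J) (f : Dist (DY J)) :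
    shiftU J s (inV f) = inV f := by
  ext a b
  exact congrFun (shift_delta H s (f b)) a

theorem shiftV_inU (H : IsSep (hbar J)) (s : DY J) (f : Dist (DY J)) :
    shiftV J s (inU f) = inU f := by
  ext a b
  exact congrFun (shift_delta H s (f a)) b

theorem shiftV_sand (H : IsSep (hbar J)) {s : DY J} (σ : Sgn) {p : (DY J)⟦X⟧} (f : Dist (DY J))
    (q : (DY J)⟦X⟧) (h : ∀ n, Commute s (PowerSeries.coeff n p)) :
    shiftV J s (sand σ p f q) = sand σ p (shift J s f) q := by
  have key : ∀ n b, shift J s (fun b => PowerSeries.coeff n (p * PowerSeries.C (f b) * q)) b =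
      PowerSeries.coeff n (p * PowerSeries.C (shift J s f b) * q) := by
    intro n b
    simp only [PowerSeries.coeff_mul _ (p * _) q, PowerSeries.coeff_mul_C]
    have e : (fun b => ∑ x ∈ Finset.HasAntidiagonal.antidiagonal n,
        PowerSeries.coeff x.1 p * f b * PowerSeries.coeff x.2 q) =
        ∑ x ∈ Finset.HasAntidiagonal.antidiagonal n, fun b =>
          PowerSeries.coeff x.1 p * f b * PowerSeries.coeff x.2 q := by
      ext b; rw [Finset.sum_apply]
    rw [e, shift_sum H, Finset.sum_apply]
    refine Finset.sum_congr rfl fun x _ => ?_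
    rw [shift_mul_right H, shift_mul_left H (h x.1)]
  ext a b
  have zero : shift J s (fun _ => (0 : DY J)) b = 0 := congrFun (shift_zero H s) b
  change shift J s (fun b => ser σ (p * PowerSeries.C (f b) * q) a) b =
    ser σ (p * PowerSeries.C (shift J s f b) * q) a
  cases σ <;> simp only [ser] <;> split_ifs
  · rw [key]
  · rw [zero]
  · rw [key]
  · rw [zero]

end Shift

end YangianDouble

end

noncomputable section

namespace YangianDouble

section Sums

variable {J : TwoSidedIdeal FreeDY} {ι : Type*}

theorem hbar_dvd_mul_left {N : ℕ} {x : DY J} (b : DY J) (h : hbar J ^ N ∣ x) :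
    hbar J ^ N ∣ b * x := by
  obtain ⟨y, rfl⟩ := h
  exact ⟨b * y, by rw [← mul_assoc, ← mul_assoc, (hbar_pow_comm N b).eq]⟩

theorem IsHSum.unique (H : IsSep (hbar J)) {f : ι → DY J} {s s' : DY J} (h : IsHSum J f s)
    (h' : IsHSum J f s') : s = s' := by
  classical
  refine eq_of_dvd H fun N => ?_
  obtain ⟨S, hS⟩ := h N
  obtain ⟨S', hS'⟩ := h' N
  have h1 : hbar J ^ N ∣ _ := hS (S ∪ S') Finset.subset_union_left
  have h2 : hbar J ^ N ∣ _ := hS' (S ∪ S') Finset.subset_union_right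
  have := dvd_sub h1 h2
  rwa [sub_sub_sub_cancel_right] at this

theorem IsHSum.add {f g : ι → DY J} {s t : DY J} (hf : IsHSum J f s) (hg : IsHSum J g t) :
    IsHSum J (fun i => f i + g i) (s + t) := by
  classical
  intro N
  obtain ⟨S, hS⟩ := hf N
  obtain ⟨S', hS'⟩ := hg N
  refine ⟨S ∪ S', fun S₁ h => ?_⟩
  have h1 : hbar J ^ N ∣ _ := hS S₁ (Finset.subset_union_left.trans h)
  have h2 : hbar J ^ N ∣ _ := hS' S₁ (Finset.subset_union_right.trans h)
  have := dvd_add h1 h2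
  rwa [← add_sub_add_comm, ← Finset.sum_add_distrib] at this

theorem IsHSum.mul_left (b : DY J) {f : ι → DY J} {s : DY J} (hf : IsHSum J f s) :
    IsHSum J (fun i => b * f i) (b * s) := by
  intro N
  obtain ⟨S, hS⟩ := hf N
  refine ⟨S, fun S₁ h => ?_⟩
  have h1 : hbar J ^ N ∣ _ := hS S₁ h
  have := hbar_dvd_mul_left b h1
  rwa [mul_sub, Finset.mul_sum] at this

theorem IsHSum.sub {f g : ι → DY J} {s t : DY J} (hf : IsHSum J f s) (hg : IsHSum J g t) :
    IsHSum J (fun i => f i - g i) (s - t) := by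
  simpa [sub_eq_add_neg] using hf.add (hg.mul_left (-1))

theorem IsHSum.comp_equiv {f : ι → DY J} {s : DY J} (hf : IsHSum J f s) (e : ι ≃ ι) :
    IsHSum J (fun i => f (e i)) s := by
  intro N
  obtain ⟨S, hS⟩ := hf N
  refine ⟨S.map e.symm.toEmbedding, fun S₁ h => ?_⟩
  have := hS (S₁.map e.toEmbedding) fun i hi => by
    rw [Finset.mem_map_equiv]
    exact h (by simpa using hi)
  rwa [Finset.sum_map] at this

theorem IsHSum.eq_zero (H : IsSep (hbar J)) {f : ι → DY J} {s : DY J} (hf : IsHSum J f s)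
    (h : ∀ i, f i = 0) : s = 0 :=
  hf.unique H fun N => ⟨∅, fun S' _ => ⟨0, by simp [h]⟩⟩

theorem exists_isHSum {f : ι → DY J} (hf : ∀ N : ℕ, {i | ¬ hbar J ^ N ∣ f i}.Finite) :
    ∃ s, IsHSum J f s := by
  classical
  let F : ℕ → Finset ι := fun N => (hf N).toFinset
  have hF : ∀ N i, i ∈ F N ↔ ¬ hbar J ^ N ∣ f i := fun N i => by simp [F]
  have hmono : ∀ N, F N ⊆ F (N + 1) := fun N i hi => by
    rw [hF] at hi ⊢
    exact fun h => hi ((pow_dvd_pow _ N.le_succ).trans h)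
  have hd : ∀ N, hbar J ^ N ∣ ∑ i ∈ F (N + 1) \ F N, f i := fun N =>
    Finset.dvd_sum fun i hi => by
      have := (Finset.mem_sdiff.1 hi).2
      rwa [hF, not_not] at this
  choose y hy using hd
  have htel : ∀ N, ∑ n ∈ Finset.range N, hbar J ^ n * y n = ∑ i ∈ F N, f i := by
    intro N
    induction N with
    | zero =>
      have : F 0 = ∅ := Finset.eq_empty_of_forall_notMem fun i hi => by
        rw [hF] at hi
        simp at hi
      simp [this]
    | succ N ih =>
      rw [Finset.sum_range_succ, ih, ← hy, add_comm, Finset.sum_sdiff (hmono N)]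
  refine ⟨hsum J y, fun N => ⟨F N, fun S' hS' => ?_⟩⟩
  have h1 := hsum_spec y N
  rw [htel] at h1
  have h2 : hbar J ^ N ∣ ∑ i ∈ S' \ F N, f i := Finset.dvd_sum fun i hi => by
    have := (Finset.mem_sdiff.1 hi).2
    rwa [hF, not_not] at this
  have := dvd_sub h1 h2
  rwa [sub_sub, add_comm, Finset.sum_sdiff hS'] at this

theorem IsProd.unique (H : IsSep (hbar J)) {r g w w' : BiDist (DY J)} (h : IsProd J r g w)
    (h' : IsProd J r g w') : w = w' := by
  ext a b
  exact (h a b).unique H (h' a b)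

theorem IsProd.sub_left {r r' g w w' : BiDist (DY J)} (h : IsProd J r g w)
    (h' : IsProd J r' g w') : IsProd J (r - r') g (w - w') := by
  intro a b
  simpa only [Pi.sub_apply, sub_mul] using (h a b).sub (h' a b)

theorem IsProd.lin {r g w : BiDist (DY J)} (h : IsProd J r g w) (s : DY J) :
    IsProd J (lin s r) g (lin s w) := by
  intro a b
  have h1 := (h (a - 1) b).comp_equiv ((Equiv.subRight (1 : ℤ)).prodCongr (Equiv.refl ℤ))
  have h2 := (h a (b - 1)).comp_equiv ((Equiv.refl ℤ).prodCongr (Equiv.subRight (1 : ℤ)))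
  have h3 := (h a b).mul_left s
  have := (h1.sub h2).add h3
  simp only [Equiv.prodCongr_apply, Prod.map_fst, Prod.map_snd, Equiv.subRight_apply,
    Equiv.refl_apply, sub_sub_sub_cancel_right] at this
  simpa only [YangianDouble.lin, add_mul, sub_mul, mul_assoc] using this

/-- The constant series `1`. -/
def oneBi : BiDist (DY J) := inU fun a => if a = 0 then 1 else 0

theorem isProd_one (g : BiDist (DY J)) : IsProd J oneBi g g := by
  intro a b N
  refine ⟨{(0, 0)}, fun S' hS' => ⟨0, ?_⟩⟩
  rw [Finset.sum_eq_single_of_mem (0, 0) (hS' (Finset.mem_singleton_self _))]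
  · simp [oneBi, inU]
  · rintro ⟨i, j⟩ - hij
    simp only [oneBi, inU]
    split_ifs with h1 h2
    · exact absurd (Prod.ext h2 h1) hij
    · simp
    · simp

theorem IsProd.suppU (H : IsSep (hbar J)) {σ : Sgn} {r g w : BiDist (DY J)} (h : IsProd J r g w)
    (hr : SuppU σ r) (hg : SuppU σ g) : SuppU σ w := fun a b hab =>
  (h a b).eq_zero H fun p => by
    rcases lt_or_ge 0 (σ.val * p.1) with hp | hp
    · rw [hr _ _ hp, zero_mul]
    · rw [hg _ _ (by rw [mul_sub]; omega), mul_zero]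

theorem IsProd.suppV (H : IsSep (hbar J)) {σ : Sgn} {r g w : BiDist (DY J)} (h : IsProd J r g w)
    (hr : SuppV σ r) (hg : SuppV σ g) : SuppV σ w := fun a b hab =>
  (h a b).eq_zero H fun p => by
    rcases lt_or_ge 0 (σ.val * p.2) with hp | hp
    · rw [hr _ _ hp, zero_mul]
    · rw [hg _ _ (by rw [mul_sub]; omega), mul_zero]

theorem suppU_inV (σ : Sgn) (f : Dist (DY J)) : SuppU σ (inV f) := fun a b h => by
  simp only [inV]
  rw [if_neg]
  rintro rfl
  simp at h

theorem suppV_inU (σ : Sgn) (f : Dist (DY J)) : SuppV σ (inU f) := fun a b h => by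
  simp only [inU]
  rw [if_neg]
  rintro rfl
  simp at h

theorem suppU_inU {σ : Sgn} {f : Dist (DY J)} (h : ∀ a, 0 < σ.val * a → f a = 0) :
    SuppU σ (inU f) := fun a b ha => by
  simp [inU, h a ha]

theorem suppV_inV {σ : Sgn} {f : Dist (DY J)} (h : ∀ a, 0 < σ.val * a → f a = 0) :
    SuppV σ (inV f) := fun a b hb => by
  simp [inV, h b hb]

/-- The expansion of `1 / (u + ħ x - v - ħ y)`. -/
def resolvent (σ : Sgn) (x y : DY J) : BiDist (DY J) := shiftU J x (shiftV J y (cauchy σ))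

theorem lin_zero_cauchy (σ : Sgn) : lin 0 (cauchy σ) = (oneBi : BiDist (DY J)) := by
  ext a b
  cases σ <;> simp only [lin, cauchy, oneBi, inU, zero_mul, add_zero] <;> split_ifs <;>
    first | omega | simp

theorem cauchy_sub_cauchy : cauchy .pos - cauchy .neg = (delta : BiDist (DY J)) := by
  ext a b
  simp only [Pi.sub_apply, cauchy, delta]
  split_ifs <;> first | omega | simp

theorem lin_resolvent (H : IsSep (hbar J)) (σ : Sgn) {x y : DY J} (hxy : Commute x y) :
    lin (hbar J * (x - y)) (resolvent σ x y) = oneBi := by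
  have h1 : Commute x (0 - hbar J * y) :=
    (Commute.zero_right x).sub_right ((hbar_comm x).symm.mul_right hxy)
  have := shiftU_lin H h1 (shiftV J y (cauchy σ))
  rw [← shiftV_lin H (Commute.zero_right y), lin_zero_cauchy, oneBi, shiftV_inU H, shiftU_inU H,
    shift_delta H] at this
  rw [resolvent, oneBi, this]
  congr 1
  rw [mul_sub]; abel

theorem deltaShift_eq (H : IsSep (hbar J)) (x y : DY J) :
    deltaShift J x y = resolvent .pos x y - resolvent .neg x y := by
  rw [deltaShift, ← cauchy_sub_cauchy, shiftV_sub H, shiftU_sub H]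
  rfl

theorem resolvent_suppU (H : IsSep (hbar J)) (σ : Sgn) (x y : DY J) :
    SuppU σ (resolvent σ x y) := fun a b h => by
  have key : ∀ a, 0 < σ.val * a → shiftV J y (cauchy σ) a b = 0 := fun a ha => by
    have : (cauchy σ : BiDist (DY J)) a = 0 := by
      ext b
      cases σ <;> simp [cauchy, Sgn.val] at ha ⊢ <;> omega
    rw [shiftV, this, shift_zero H, Pi.zero_apply]
  exact shift_support H x (f := fun a => shiftV J y (cauchy σ) a b) key a h

theorem resolvent_suppV (H : IsSep (hbar J)) (σ : Sgn) (x y : DY J) :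
    SuppV σ.flip (resolvent σ x y) := fun a b h => by
  have : (fun a => shiftV J y (cauchy σ) a b) = 0 := by
    ext a
    refine shift_support H y (σ := σ.flip) (fun b hb => ?_) b h
    cases σ <;> simp [cauchy, Sgn.val, Sgn.flip] at hb ⊢ <;> omega
  rw [resolvent, shiftU, this]
  exact congrFun (shift_zero H x) a

/-- The coefficient of `u^a v^b` vanishes for `a + b ≥ 0` and is divisible by `ħ^(-1-a-b)`. -/
def IsDeg (g : BiDist (DY J)) : Prop :=
  ∀ a b, (0 ≤ a + b → g a b = 0) ∧ ∀ N : ℕ, a + b + 1 + N ≤ 0 → hbar J ^ N ∣ g a b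

theorem dvd_shift_term {x : DY J} {z : ℤ} {n N : ℕ} {s : DY J}
    (h : ∀ M : ℕ, M + n ≤ N → hbar J ^ M ∣ x) :
    hbar J ^ N ∣ hbar J ^ n * (z • (s ^ n * x)) ∨ N < n := by
  rcases lt_or_ge N n with hn | hn
  · exact Or.inr hn
  · left
    obtain ⟨k, rfl⟩ := Nat.exists_eq_add_of_le' hn
    rw [add_comm, pow_add]
    refine mul_dvd_mul_left _ ?_
    rw [← Int.cast_smul_eq_zsmul (DY J), smul_eq_mul]
    exact hbar_dvd_mul_left _ (hbar_dvd_mul_left _ (h k le_rfl))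

theorem dvd_shift {s : DY J} {f : Dist (DY J)} {a : ℤ} {N : ℕ}
    (h : ∀ n M : ℕ, M + n ≤ N → hbar J ^ M ∣ f (a + n)) : hbar J ^ N ∣ shift J s f a := by
  refine dvd_hsum fun n hn => ?_
  rcases dvd_shift_term (z := Ring.choose (a + (n : ℤ)) n) (s := s) (h n) with h | h
  · exact h
  · omega

theorem shift_eq_zero (H : IsSep (hbar J)) {s : DY J} {f : Dist (DY J)} {a : ℤ}
    (h : ∀ n : ℕ, f (a + n) = 0) : shift J s f a = 0 :=
  hsum_eq_zero H fun n => by rw [h, mul_zero, smul_zero]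

theorem IsDeg.shiftV (H : IsSep (hbar J)) {g : BiDist (DY J)} (hg : IsDeg g) (s : DY J) :
    IsDeg (shiftV J s g) := by
  intro a b
  rw [YangianDouble.shiftV]
  constructor
  · intro h
    exact shift_eq_zero H (f := g a) fun n => (hg a _).1 (by omega)
  · intro N hN
    exact dvd_shift (f := g a) fun n M hM => (hg a _).2 M (by omega)

theorem IsDeg.shiftU (H : IsSep (hbar J)) {g : BiDist (DY J)} (hg : IsDeg g) (s : DY J) :
    IsDeg (shiftU J s g) := by
  intro a b
  rw [YangianDouble.shiftU]
  constructor
  · intro h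
    exact shift_eq_zero H (f := fun a => g a b) fun n => (hg _ b).1 (by omega)
  · intro N hN
    exact dvd_shift (f := fun a => g a b) fun n M hM => (hg _ b).2 M (by omega)

theorem isDeg_resolvent (H : IsSep (hbar J)) (σ : Sgn) (x y : DY J) :
    IsDeg (resolvent σ x y) := by
  have h1 : IsDeg (cauchy σ : BiDist (DY J)) := by
    intro a b
    constructor
    · intro h
      cases σ <;> simp only [cauchy] <;> rw [if_neg] <;> omega
    · intro N hN
      rcases N with _ | N
      · simp
      · have : (cauchy σ : BiDist (DY J)) a b = 0 := by
          cases σ <;> simp only [cauchy] <;> rw [if_neg] <;> omega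
        rw [this]
        exact dvd_zero _
  exact (h1.shiftV H y).shiftU H x

theorem IsDeg.exists_isProd_inV {r : BiDist (DY J)} (hr : IsDeg r) (f : Dist (DY J)) :
    ∃ w, IsProd J r (inV f) w := by
  have : ∀ a b : ℤ, ∃ s, IsHSum J (fun p : ℤ × ℤ => r p.1 p.2 * inV f (a - p.1) (b - p.2)) s := by
    intro a b
    refine exists_isHSum fun N => (Set.finite_Icc ((a, -N - a - 1) : ℤ × ℤ) (a, -a)).subset ?_
    rintro ⟨i, j⟩ hij
    simp only [Set.mem_ofPred_eq, inV] at hij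
    by_cases hi : a - i = 0
    · obtain rfl : a = i := by omega
      by_contra hc
      simp only [Set.mem_Icc, Prod.mk_le_mk, le_refl, true_and, not_and_or, not_le] at hc
      apply hij
      rcases hc with hc | hc
      · obtain ⟨y, hy⟩ := (hr a j).2 N (by omega)
        rw [hy, mul_assoc]
        exact dvd_mul_right _ _
      · rw [(hr a j).1 (by omega), zero_mul]
        exact dvd_zero _
    · rw [if_neg hi, mul_zero] at hij
      exact absurd (dvd_zero _) hij
  choose w hw using this
  exact ⟨w, hw⟩

theorem IsDeg.exists_isProd_inU {r : BiDist (DY J)} (hr : IsDeg r) (f : Dist (DY J)) :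
    ∃ w, IsProd J r (inU f) w := by
  have : ∀ a b : ℤ, ∃ s, IsHSum J (fun p : ℤ × ℤ => r p.1 p.2 * inU f (a - p.1) (b - p.2)) s := by
    intro a b
    refine exists_isHSum fun N => (Set.finite_Icc ((-N - b - 1, b) : ℤ × ℤ) (-b, b)).subset ?_
    rintro ⟨i, j⟩ hij
    simp only [Set.mem_ofPred_eq, inU] at hij
    by_cases hj : b - j = 0
    · obtain rfl : b = j := by omega
      by_contra hc
      simp only [Set.mem_Icc, Prod.mk_le_mk, le_refl, and_true, not_and_or, not_le] at hc
      apply hij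
      rcases hc with hc | hc
      · obtain ⟨y, hy⟩ := (hr i b).2 N (by omega)
        rw [hy, mul_assoc]
        exact dvd_mul_right _ _
      · rw [(hr i b).1 (by omega), zero_mul]
        exact dvd_zero _
    · rw [if_neg hj, mul_zero] at hij
      exact absurd (dvd_zero _) hij
  choose w hw using this
  exact ⟨w, hw⟩

theorem exists_isProd_of_supp {σ τ : Sgn} {r g : BiDist (DY J)} (hrU : SuppU σ r)
    (hrV : SuppV τ r) (hgU : SuppU σ g) (hgV : SuppV τ g) : ∃ w, IsProd J r g w := by
  have : ∀ a b : ℤ, ∃ s, IsHSum J (fun p : ℤ × ℤ => r p.1 p.2 * g (a - p.1) (b - p.2)) s := by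
    intro a b
    refine exists_isHSum fun N =>
      (Set.finite_Icc ((min a 0, min b 0) : ℤ × ℤ) (max a 0, max b 0)).subset ?_
    rintro ⟨i, j⟩ hij
    by_contra hc
    apply hij
    have key : r i j = 0 ∨ g (a - i) (b - j) = 0 := by
      by_contra! hne
      have h1 := not_lt.1 fun h => hne.1 (hrU i j h)
      have h2 := not_lt.1 fun h => hne.1 (hrV i j h)
      have h3 := not_lt.1 fun h => hne.2 (hgU (a - i) (b - j) h)
      have h4 := not_lt.1 fun h => hne.2 (hgV (a - i) (b - j) h)
      simp only [Set.mem_Icc, Prod.mk_le_mk] at hc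
      apply hc
      cases σ <;> cases τ <;> simp only [Sgn.val] at h1 h2 h3 h4 <;> omega
    rcases key with h | h
    · simp [h]
    · simp [h]
  choose w hw using this
  exact ⟨w, hw⟩

theorem IsProd.lin_resolvent (H : IsSep (hbar J)) {σ : Sgn} {x y : DY J} (hxy : Commute x y)
    {g w : BiDist (DY J)} (h : IsProd J (resolvent σ x y) g w) :
    YangianDouble.lin (hbar J * (x - y)) w = g := by
  have := h.lin (hbar J * (x - y))
  rw [YangianDouble.lin_resolvent H σ hxy] at this
  exact this.unique H (isProd_one g)

end Sums

end YangianDouble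

end

noncomputable section

namespace YangianDouble

section Currents

variable {J : TwoSidedIdeal FreeDY}

theorem pm_flip (σ : Sgn) : pm J σ.flip = -pm J σ := by
  cases σ <;> simp [pm, Sgn.flip, Sgn.val]

theorem pm_comm (σ τ : Sgn) : Commute (pm J σ) (pm J τ) :=
  ((Commute.refl (c4 J)).intCast_mul_right _).intCast_mul_left _

theorem CommC.pm_coeff {p : (DY J)⟦X⟧} (hp : CommC p) (ρ : Sgn) (n : ℕ) :
    Commute (pm J ρ) (PowerSeries.coeff n p) := (hp n).intCast_mul_left _

theorem CommC.pm_ser {p : (DY J)⟦X⟧} (hp : CommC p) (ρ σ : Sgn) (a : ℤ) :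
    Commute (pm J ρ) (ser σ p a) := by
  have h := hp.pm_coeff ρ
  cases σ <;> simp only [ser] <;> split_ifs
  exacts [h _, Commute.zero_right _, h _, Commute.zero_right _]

theorem commute_shift (H : IsSep (hbar J)) {s r : DY J} {f : Dist (DY J)} (hs : Commute r s)
    (hf : ∀ a, Commute r (f a)) (a : ℤ) : Commute r (shift J s f a) := by
  have h1 := shift_mul_left H hs.symm f a
  have h2 := shift_mul_right H s r f a
  have : (fun a => r * f a) = fun a => f a * r := funext fun a => (hf a).eq
  rw [this, h2] at h1
  exact h1.symm

/-- The summand `t_{11}^σ(u)⁻¹ t_{12}^σ(u)` of `X^+` with its shift. -/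
def curE (J : TwoSidedIdeal FreeDY) (σ : Sgn) : Dist (DY J) := shift J (pm J σ.flip) (ser σ (e J σ))

/-- The summand `t_{21}^σ(u) t_{11}^σ(u)⁻¹` of `X^-` with its shift. -/
def curF (J : TwoSidedIdeal FreeDY) (σ : Sgn) : Dist (DY J) := shift J (pm J σ) (ser σ (f J σ))

theorem Xcur_pos : Xcur J .pos = curE J .pos - curE J .neg := rfl

theorem Xcur_neg : Xcur J .neg = curF J .pos - curF J .neg := rfl

theorem sand_sub (σ : Sgn) (p q : (DY J)⟦X⟧) (f g : Dist (DY J)) :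
    sand σ p (f - g) q = sand σ p f q - sand σ p g q := by
  ext a b
  simp [sand, ser_eq, mul_sub, sub_mul]

theorem inV_sub (f g : Dist (DY J)) : inV (f - g) = inV f - inV g := by
  ext a b
  simp only [inV, Pi.sub_apply]
  split_ifs <;> simp

theorem suppU_sand (σ : Sgn) (p q : (DY J)⟦X⟧) (f : Dist (DY J)) : SuppU σ (sand σ p f q) :=
  fun _ _ h => ser_support σ _ _ h

theorem outer_eq_iff {σ τ : Sgn} {p q : (DY J)⟦X⟧} :
    outer (ser σ p) (ser τ q) = outerRev (ser σ p) (ser τ q) ↔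
      ∀ m n, Commute (PowerSeries.coeff m p) (PowerSeries.coeff n q) := by
  constructor
  · intro h m n
    have hc : ∀ (σ : Sgn) (p : (DY J)⟦X⟧) (n : ℕ), ser σ p (-(σ.val * n)) = PowerSeries.coeff n p := by
      intro σ p n
      cases σ <;> simp [ser, Sgn.val]
    have := congrFun (congrFun h (-(σ.val * m))) (-(τ.val * n))
    rw [outer, outerRev, hc, hc] at this
    exact this
  · intro h
    ext a b
    have : Commute (ser σ p a) (ser τ q b) := by
      cases σ <;> cases τ <;> simp only [ser] <;> split_ifs <;>
        first | exact h _ _ | exact Commute.zero_left _ | exact Commute.zero_right _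
    exact this.eq

theorem hbar_mul_comm {x y : DY J} (h : Commute x y) : Commute (hbar J * x) (hbar J * y) :=
  (hbar_comm _).mul_left ((hbar_comm x).symm.mul_right h)

/-- The characterisation of the action of `(U - v + r ħ) / (U - v + s ħ)` on series in `v`. -/
theorem isProd_frac (H : IsSep (hbar J)) {σ : Sgn} {x : DY J} {r s : ℤ} {X : Dist (DY J)}
    {W : BiDist (DY J)} (hW : SuppU σ W)
    (h : lin (hbar J * (x + s)) W = lin (hbar J * (x + r)) (inV X)) :
    IsProd J (frac J σ x 0 r s) (inV X) W := by
  obtain ⟨w, hw⟩ := (isDeg_resolvent H σ (x + (s : DY J)) 0).exists_isProd_inV X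
  have h1 := hw.lin_resolvent H (Commute.zero_right _)
  have h2 := hw.lin (hbar J * (x - 0 + (r : DY J)))
  have h3 : SuppU σ w := hw.suppU H (resolvent_suppU H _ _ _) (suppU_inV _ _)
  rw [sub_zero] at h1 h2
  have h4 : lin (hbar J * (x + (r : DY J))) w = W := by
    refine eq_of_lin_eqU H (s := x + s) (σ := σ) 1 (SuppU.lin _ (n := 0) h3)
      (fun a b hab => hW a b (by omega)) ?_
    rw [h, ← h1]
    have hx : Commute (x + (s : DY J)) (x + (r : DY J)) :=
      ((Commute.refl x).add_right (Int.cast_commute r x).symm).add_left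
        ((Int.cast_commute s x).add_right (Int.cast_commute s (r : DY J)))
    exact lin_comm (hbar_mul_comm hx) _
  rw [h4] at h2
  rwa [frac, sub_zero]

theorem exists_pm_sub (σ τ : Sgn) : ∃ m : ℤ, pm J σ - pm J τ = m * c4 J :=
  ⟨σ.val - τ.val, by rw [pm, pm, ← sub_mul, Int.cast_sub]⟩

theorem pm_comm_hbar_mul (ρ : Sgn) {x : DY J} (h : Commute (pm J ρ) x) :
    Commute (pm J ρ) (hbar J * x) :=
  (hbar_comm _).symm.mul_right h

theorem pm_comm_offset (ρ σ τ : Sgn) : Commute (pm J ρ) (hbar J * (pm J σ - pm J τ)) :=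
  pm_comm_hbar_mul ρ ((pm_comm ρ σ).sub_right (pm_comm ρ τ))

theorem commute_hbar (x : DY J) : Commute x (hbar J) := (hbar_comm x).symm

theorem IsRelIdeal.k1_curE (hJ : IsRelIdeal J) (σ τ : Sgn) :
    lin (hbar J * pm J σ) (sand σ (Ring.inverse (k1 J σ)) (curE J τ) (k1 J σ)) =
      lin (hbar J * (pm J σ + 1)) (inV (curE J τ)) - hbar J • inU (ser σ (e J σ)) := by
  have H := hJ.isSep
  obtain ⟨-, -, -, r, -⟩ := (hJ.biRTT σ τ).relations H (exists_pm_sub τ σ) (exists_pm_sub σ τ)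
    (hJ.gaussSeries σ) (hJ.gaussSeries τ)
  have r := congrArg (shiftV J (pm J τ.flip)) r
  have hp := (hJ.commC_k1 σ).inverse.pm_coeff τ.flip
  rw [shiftV_sub H, shiftV_smul H (commute_hbar _), shiftV_inU H,
    shiftV_lin H (pm_comm_offset _ _ _),
    shiftV_lin H ((pm_comm_offset _ _ _).add_right (commute_hbar _)), shiftV_inV H,
    shiftV_sand H _ _ _ hp] at r
  rw [pm_flip] at r
  have e1 : hbar J * (pm J σ - pm J τ) - hbar J * -pm J τ = hbar J * pm J σ := by noncomm_ring
  have e2 : hbar J * (pm J σ - pm J τ) + hbar J - hbar J * -pm J τ = hbar J * (pm J σ + 1) := by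
    noncomm_ring
  rw [e1, e2, ← pm_flip] at r
  exact r

theorem IsRelIdeal.k1_curF (hJ : IsRelIdeal J) (σ τ : Sgn) :
    lin (hbar J * pm J σ.flip) (sand σ (k1 J σ) (curF J τ) (Ring.inverse (k1 J σ))) =
      lin (hbar J * (pm J σ.flip + 1)) (inV (curF J τ)) - hbar J • inU (ser σ (f J σ)) := by
  have H := hJ.isSep
  obtain ⟨-, -, -, -, r, -⟩ := (hJ.biRTT σ τ).relations H (exists_pm_sub τ σ) (exists_pm_sub σ τ)
    (hJ.gaussSeries σ) (hJ.gaussSeries τ)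
  have r := congrArg (shiftV J (pm J τ)) r
  have hp := (hJ.commC_k1 σ).pm_coeff τ
  rw [shiftV_sub H, shiftV_smul H (commute_hbar _), shiftV_inU H,
    shiftV_lin H (pm_comm_offset _ _ _),
    shiftV_lin H ((pm_comm_offset _ _ _).add_right (commute_hbar _)), shiftV_inV H,
    shiftV_sand H _ _ _ hp] at r
  have e1 : hbar J * (pm J τ - pm J σ) - hbar J * pm J τ = hbar J * -pm J σ := by noncomm_ring
  have e2 : hbar J * (pm J τ - pm J σ) + hbar J - hbar J * pm J τ = hbar J * (-pm J σ + 1) := by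
    noncomm_ring
  rw [e1, e2, ← pm_flip] at r
  exact r

theorem IsRelIdeal.k2_curE (hJ : IsRelIdeal J) (σ τ : Sgn) :
    lin (hbar J * pm J σ) (sand σ (Ring.inverse (k2 J σ)) (curE J τ) (k2 J σ)) =
      lin (hbar J * (pm J σ + -1)) (inV (curE J τ)) + hbar J • inU (ser σ (e J σ)) := by
  have H := hJ.isSep
  obtain ⟨-, -, -, -, -, r, -⟩ := (hJ.biRTT σ τ).relations H (exists_pm_sub τ σ)
    (exists_pm_sub σ τ) (hJ.gaussSeries σ) (hJ.gaussSeries τ)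
  have r := congrArg (shiftV J (pm J τ.flip)) r
  have hp := (hJ.commC_k2 σ).inverse.pm_coeff τ.flip
  rw [shiftV_add H, shiftV_smul H (commute_hbar _), shiftV_inU H,
    shiftV_lin H (pm_comm_offset _ _ _),
    shiftV_lin H ((pm_comm_offset _ _ _).sub_right (commute_hbar _)), shiftV_inV H,
    shiftV_sand H _ _ _ hp] at r
  rw [pm_flip] at r
  have e1 : hbar J * (pm J σ - pm J τ) - hbar J * -pm J τ = hbar J * pm J σ := by noncomm_ring
  have e2 : hbar J * (pm J σ - pm J τ) - hbar J - hbar J * -pm J τ = hbar J * (pm J σ + -1) := by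
    noncomm_ring
  rw [e1, e2, ← pm_flip] at r
  exact r

theorem IsRelIdeal.k2_curF (hJ : IsRelIdeal J) (σ τ : Sgn) :
    lin (hbar J * pm J σ.flip) (sand σ (k2 J σ) (curF J τ) (Ring.inverse (k2 J σ))) =
      lin (hbar J * (pm J σ.flip + -1)) (inV (curF J τ)) + hbar J • inU (ser σ (f J σ)) := by
  have H := hJ.isSep
  obtain ⟨-, -, -, -, -, -, r, -⟩ := (hJ.biRTT σ τ).relations H (exists_pm_sub τ σ)
    (exists_pm_sub σ τ) (hJ.gaussSeries σ) (hJ.gaussSeries τ)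
  have r := congrArg (shiftV J (pm J τ)) r
  have hp := (hJ.commC_k2 σ).pm_coeff τ
  rw [shiftV_add H, shiftV_smul H (commute_hbar _), shiftV_inU H,
    shiftV_lin H (pm_comm_offset _ _ _),
    shiftV_lin H ((pm_comm_offset _ _ _).sub_right (commute_hbar _)), shiftV_inV H,
    shiftV_sand H _ _ _ hp] at r
  have e1 : hbar J * (pm J τ - pm J σ) - hbar J * pm J τ = hbar J * -pm J σ := by noncomm_ring
  have e2 : hbar J * (pm J τ - pm J σ) - hbar J - hbar J * pm J τ = hbar J * (-pm J σ + -1) := by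
    noncomm_ring
  rw [e1, e2, ← pm_flip] at r
  exact r

/-- The rational factors for the action on a current which is the difference of two summands. -/
theorem isProd_frac_sub (H : IsSep (hbar J)) {σ : Sgn} {x : DY J} {r : ℤ} {p q : (DY J)⟦X⟧}
    {X Y : Dist (DY J)} {Z : BiDist (DY J)}
    (hX : lin (hbar J * x) (sand σ p X q) = lin (hbar J * (x + r)) (inV X) + Z)
    (hY : lin (hbar J * x) (sand σ p Y q) = lin (hbar J * (x + r)) (inV Y) + Z) :
    IsProd J (frac J σ x 0 r 0) (inV (X - Y)) (sandwich J σ p (X - Y) q) := by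
  refine isProd_frac H (suppU_sand σ p q (X - Y)) ?_
  rw [Int.cast_zero, add_zero]
  change lin _ (sand σ p (X - Y) q) = _
  rw [sand_sub, inV_sub, lin_sub, lin_sub, hX, hY, add_sub_add_right_eq_sub]

theorem IsRelIdeal.curE_curE (hJ : IsRelIdeal J) (σ τ : Sgn) :
    lin (-hbar J) (outer (curE J σ) (curE J τ)) - lin (hbar J) (outerRev (curE J σ) (curE J τ)) =
      -(hbar J • (inU (shift J (pm J σ.flip) (ser σ (e J σ * e J σ))) +
        inV (shift J (pm J τ.flip) (ser τ (e J τ * e J τ))))) := by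
  have H := hJ.isSep
  obtain ⟨-, -, -, -, -, -, -, r, -⟩ := (hJ.biRTT σ τ).relations H (exists_pm_sub τ σ)
    (exists_pm_sub σ τ) (hJ.gaussSeries σ) (hJ.gaussSeries τ)
  have r := congrArg (fun g => shiftU J (pm J σ.flip) (shiftV J (pm J τ.flip) g)) r
  have c0 : ∀ ρ, Commute (pm J ρ) (hbar J * (pm J σ - pm J τ)) := fun ρ => pm_comm_offset _ _ _
  have c1 : ∀ ρ ρ', Commute (pm J ρ) (hbar J * pm J ρ') := fun ρ ρ' =>
    pm_comm_hbar_mul ρ (pm_comm _ _)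
  simp only [shiftV_sub H, shiftU_sub H, shiftV_neg H, shiftU_neg H, shiftV_smul H (commute_hbar _),
    shiftU_smul H (commute_hbar _), shiftV_add H, shiftU_add H, shiftV_inU H, shiftV_inV H,
    shiftU_inU H, shiftU_inV H] at r
  rw [shiftV_lin H ((c0 _).sub_right (commute_hbar _)),
    shiftV_lin H ((c0 _).add_right (commute_hbar _)),
    shiftU_lin H (((c0 _).sub_right (commute_hbar _)).sub_right (c1 _ _)),
    shiftU_lin H (((c0 _).add_right (commute_hbar _)).sub_right (c1 _ _)),
    shiftV_outer H _ ((hJ.commC_e σ).pm_ser _ _), shiftV_outerRev H, shiftU_outer H,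
    shiftU_outerRev H _ (commute_shift H (pm_comm _ _) ((hJ.commC_e τ).pm_ser _ _)),
    pm_flip, pm_flip] at r
  have e1 : hbar J * (pm J σ - pm J τ) - hbar J - hbar J * -pm J τ + hbar J * -pm J σ =
    -hbar J := by noncomm_ring
  have e2 : hbar J * (pm J σ - pm J τ) + hbar J - hbar J * -pm J τ + hbar J * -pm J σ =
    hbar J := by noncomm_ring
  rw [e1, e2, ← pm_flip, ← pm_flip] at r
  exact r

theorem IsRelIdeal.curF_curF (hJ : IsRelIdeal J) (σ τ : Sgn) :
    lin (hbar J) (outer (curF J σ) (curF J τ)) - lin (-hbar J) (outerRev (curF J σ) (curF J τ)) =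
      hbar J • (inU (shift J (pm J σ) (ser σ (f J σ * f J σ))) +
        inV (shift J (pm J τ) (ser τ (f J τ * f J τ)))) := by
  have H := hJ.isSep
  obtain ⟨-, -, -, -, -, -, -, -, r, -⟩ := (hJ.biRTT σ τ).relations H (exists_pm_sub τ σ)
    (exists_pm_sub σ τ) (hJ.gaussSeries σ) (hJ.gaussSeries τ)
  have r := congrArg (fun g => shiftU J (pm J σ) (shiftV J (pm J τ) g)) r
  have c0 : ∀ ρ, Commute (pm J ρ) (hbar J * (pm J τ - pm J σ)) := fun ρ => pm_comm_offset _ _ _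
  have c1 : ∀ ρ ρ', Commute (pm J ρ) (hbar J * pm J ρ') := fun ρ ρ' =>
    pm_comm_hbar_mul ρ (pm_comm _ _)
  simp only [shiftV_sub H, shiftU_sub H, shiftV_smul H (commute_hbar _),
    shiftU_smul H (commute_hbar _), shiftV_add H, shiftU_add H, shiftV_inU H, shiftV_inV H,
    shiftU_inU H, shiftU_inV H] at r
  rw [shiftV_lin H ((c0 _).sub_right (commute_hbar _)),
    shiftV_lin H ((c0 _).add_right (commute_hbar _)),
    shiftU_lin H (((c0 _).sub_right (commute_hbar _)).sub_right (c1 _ _)),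
    shiftU_lin H (((c0 _).add_right (commute_hbar _)).sub_right (c1 _ _)),
    shiftV_outer H _ ((hJ.commC_f σ).pm_ser _ _), shiftV_outerRev H, shiftU_outer H,
    shiftU_outerRev H _ (commute_shift H (pm_comm _ _) ((hJ.commC_f τ).pm_ser _ _))] at r
  have e1 : hbar J * (pm J τ - pm J σ) - hbar J - hbar J * pm J τ + hbar J * pm J σ =
    -hbar J := by noncomm_ring
  have e2 : hbar J * (pm J τ - pm J σ) + hbar J - hbar J * pm J τ + hbar J * pm J σ =
    hbar J := by noncomm_ring
  rw [e1, e2] at r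
  exact r

theorem IsRelIdeal.k1_k2inv (hJ : IsRelIdeal J) (σ : Sgn) :
    outer (ser σ (k1 J σ)) (ser σ (Ring.inverse (k2 J σ))) =
      outerRev (ser σ (k1 J σ)) (ser σ (Ring.inverse (k2 J σ))) := by
  have H := hJ.isSep
  obtain ⟨-, -, r, -⟩ := (hJ.biRTT σ σ).relations H (exists_pm_sub σ σ)
    (exists_pm_sub σ σ) (hJ.gaussSeries σ) (hJ.gaussSeries σ)
  have e1 : hbar J * (pm J σ - pm J σ) + hbar J = hbar J * 1 := by noncomm_ring
  rw [e1] at r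
  have h1 : SuppU σ (outer (ser σ (k1 J σ)) (ser σ (Ring.inverse (k2 J σ)))) := fun a b h => by
    rw [outer, ser_support σ _ a h, zero_mul]
  have h2 : SuppU σ (outerRev (ser σ (k1 J σ)) (ser σ (Ring.inverse (k2 J σ)))) := fun a b h => by
    rw [outerRev, ser_support σ _ a h, mul_zero]
  exact (eq_of_lin_eqU H 0 h2 h1 (eq_of_lin_eqU H (0 + 1) (SuppU.lin _ h2) (SuppU.lin _ h1) r)).symm

theorem IsRelIdeal.coeff_k1_k2 (hJ : IsRelIdeal J) (σ : Sgn) (m n : ℕ) :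
    Commute (PowerSeries.coeff m (k1 J σ)) (PowerSeries.coeff n (k2 J σ)) := by
  have h := outer_eq_iff.1 (hJ.k1_k2inv σ) m
  have h1 : Commute (PowerSeries.C (PowerSeries.coeff m (k1 J σ))) (Ring.inverse (k2 J σ)) :=
    C_mul_comm h
  obtain ⟨u, hu⟩ := isUnit_k2 (J := J) σ
  rw [← hu, Ring.inverse_unit] at h1
  have h2 := h1.units_inv_right
  rw [inv_inv, hu] at h2
  have := congrArg (PowerSeries.coeff n) h2.eq
  rwa [PowerSeries.coeff_C_mul, PowerSeries.coeff_mul_C] at this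

theorem IsRelIdeal.k2_k1 (hJ : IsRelIdeal J) (σ : Sgn) :
    k2 J σ * k1 J σ = k1 J σ * k2 J σ := by
  ext n
  rw [PowerSeries.coeff_mul, PowerSeries.coeff_mul]
  refine Finset.sum_equiv (Equiv.prodComm ℕ ℕ) (fun x => ?_) fun x _ => ?_
  · simp [add_comm]
  · exact (hJ.coeff_k1_k2 σ x.2 x.1).eq.symm

theorem IsRelIdeal.curE_curF (hJ : IsRelIdeal J) (σ τ : Sgn) :
    lin (hbar J * (pm J σ.flip - pm J σ)) (lin (hbar J * (pm J τ.flip - pm J τ))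
      (outer (curE J σ) (curF J τ) - outerRev (curE J σ) (curF J τ))) =
    hbar J • (lin (hbar J * (pm J σ.flip - pm J σ)) (inV (shift J (pm J τ) (ser τ (k2k1inv J τ)))) -
      lin (hbar J * (pm J τ.flip - pm J τ))
        (inU (shift J (pm J σ.flip) (ser σ (k2k1inv J σ))))) := by
  have H := hJ.isSep
  obtain ⟨-, -, -, -, -, -, -, -, -, r⟩ := (hJ.biRTT σ τ).relations H (exists_pm_sub τ σ)
    (exists_pm_sub σ τ) (hJ.gaussSeries σ) (hJ.gaussSeries τ)
  have r := congrArg (fun g => shiftU J (pm J σ.flip) (shiftV J (pm J τ) g)) (r (hJ.k2_k1 σ))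
  have c0 : ∀ ρ σ τ, Commute (pm J ρ) (hbar J * (pm J σ - pm J τ)) :=
    fun ρ σ τ => pm_comm_offset _ _ _
  have c1 : ∀ ρ ρ', Commute (pm J ρ) (hbar J * pm J ρ') := fun ρ ρ' =>
    pm_comm_hbar_mul ρ (pm_comm _ _)
  simp only [shiftV_sub H, shiftU_sub H, shiftV_smul H (commute_hbar _),
    shiftU_smul H (commute_hbar _), shiftV_inU H, shiftV_inV H, shiftU_inU H, shiftU_inV H,
    shiftV_lin H (c0 _ _ _), shiftU_lin H ((c0 _ _ _).sub_right (c1 _ _))] at r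
  rw [shiftV_outer H _ ((hJ.commC_e σ).pm_ser _ _), shiftV_outerRev H, shiftU_outer H,
    shiftU_outerRev H _ (commute_shift H (pm_comm _ _) ((hJ.commC_f τ).pm_ser _ _))] at r
  have e1 : hbar J * (pm J τ - pm J σ) - hbar J * pm J τ + hbar J * pm J σ.flip =
    hbar J * (pm J σ.flip - pm J σ) := by noncomm_ring
  have e2 : hbar J * (pm J σ - pm J τ) - hbar J * pm J τ + hbar J * pm J σ.flip =
    hbar J * (pm J τ.flip - pm J τ) := by
    rw [pm_flip, pm_flip]; noncomm_ring
  rw [e1, e2] at r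
  exact r

end Currents

end YangianDouble

end

noncomputable section

namespace YangianDouble

section Final

variable {J : TwoSidedIdeal FreeDY}

theorem suppU_outer {σ : Sgn} {f : Dist (DY J)} (g : Dist (DY J))
    (hf : ∀ a, 0 < σ.val * a → f a = 0) : SuppU σ (outer f g) := fun a b h => by
  rw [outer, hf a h, zero_mul]

theorem suppU_outerRev {σ : Sgn} {f : Dist (DY J)} (g : Dist (DY J))
    (hf : ∀ a, 0 < σ.val * a → f a = 0) : SuppU σ (outerRev f g) := fun a b h => by
  rw [outerRev, hf a h, mul_zero]

theorem suppV_outer {τ : Sgn} (f : Dist (DY J)) {g : Dist (DY J)}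
    (hg : ∀ a, 0 < τ.val * a → g a = 0) : SuppV τ (outer f g) := fun a b h => by
  rw [outer, hg b h, mul_zero]

theorem suppV_outerRev {τ : Sgn} (f : Dist (DY J)) {g : Dist (DY J)}
    (hg : ∀ a, 0 < τ.val * a → g a = 0) : SuppV τ (outerRev f g) := fun a b h => by
  rw [outerRev, hg b h, zero_mul]

theorem IsRelIdeal.k_comm (hJ : IsRelIdeal J) (i j : Fin 2) (σ : Sgn) :
    outer (ser σ (k J i σ)) (ser σ (k J j σ)) = outerRev (ser σ (k J i σ)) (ser σ (k J j σ)) := by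
  obtain ⟨r1, r2, -⟩ := (hJ.biRTT σ σ).relations hJ.isSep (exists_pm_sub σ σ)
    (exists_pm_sub σ σ) (hJ.gaussSeries σ) (hJ.gaussSeries σ)
  fin_cases i <;> fin_cases j
  · exact r1
  · exact outer_eq_iff.2 (hJ.coeff_k1_k2 σ)
  · exact outer_eq_iff.2 fun m n => (hJ.coeff_k1_k2 σ n m).symm
  · exact r2

theorem IsRelIdeal.k_comm_mixed (hJ : IsRelIdeal J) (i : Fin 2) (σ τ : Sgn) :
    outer (ser σ (k J i σ)) (ser τ (k J i τ)) = outerRev (ser σ (k J i σ)) (ser τ (k J i τ)) := by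
  obtain ⟨r1, r2, -⟩ := (hJ.biRTT σ τ).relations hJ.isSep (exists_pm_sub τ σ)
    (exists_pm_sub σ τ) (hJ.gaussSeries σ) (hJ.gaussSeries τ)
  fin_cases i
  exacts [r1, r2]

theorem IsRelIdeal.k1_k2inv_mixed (hJ : IsRelIdeal J) (σ : Sgn) : ∃ w : BiDist (DY J),
    IsProd J (frac J σ (pm J σ.flip) (pm J σ) 0 1)
      (outerRev (ser σ (k1 J σ)) (ser σ.flip (Ring.inverse (k2 J σ.flip)))) w ∧
    IsProd J (frac J σ (pm J σ) (pm J σ.flip) 0 1)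
      (outer (ser σ (k1 J σ)) (ser σ.flip (Ring.inverse (k2 J σ.flip)))) w := by
  have H := hJ.isSep
  obtain ⟨-, -, r, -⟩ := (hJ.biRTT σ σ.flip).relations H (exists_pm_sub σ.flip σ)
    (exists_pm_sub σ σ.flip) (hJ.gaussSeries σ) (hJ.gaussSeries σ.flip)
  set f := ser σ (k1 J σ)
  set g := ser σ.flip (Ring.inverse (k2 J σ.flip))
  have hf : ∀ a, 0 < σ.val * a → f a = 0 := ser_support σ _
  have hg : ∀ a, 0 < σ.flip.val * a → g a = 0 := ser_support σ.flip _
  have hc : ∀ σ τ : Sgn, Commute (pm J σ + ((1 : ℤ) : DY J)) (pm J τ) := fun σ τ =>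
    (pm_comm σ τ).add_left (Int.cast_commute 1 _)
  obtain ⟨w₁, h₁⟩ := exists_isProd_of_supp (resolvent_suppU H σ (pm J σ.flip + (1 : ℤ)) (pm J σ))
    (resolvent_suppV H σ _ _) (suppU_outerRev g hf) (suppV_outerRev f hg)
  obtain ⟨w₂, h₂⟩ := exists_isProd_of_supp (resolvent_suppU H σ (pm J σ + (1 : ℤ)) (pm J σ.flip))
    (resolvent_suppV H σ _ _) (suppU_outer g hf) (suppV_outer f hg)
  have s₁ : SuppU σ w₁ := h₁.suppU H (resolvent_suppU H σ _ _) (suppU_outerRev g hf)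
  have s₂ : SuppU σ w₂ := h₂.suppU H (resolvent_suppU H σ _ _) (suppU_outer g hf)
  have l₁ := h₁.lin_resolvent H (hc _ _)
  have l₂ := h₂.lin_resolvent H (hc _ _)
  have p₁ := h₁.lin (hbar J * (pm J σ.flip - pm J σ + ((0 : ℤ) : DY J)))
  have p₂ := h₂.lin (hbar J * (pm J σ - pm J σ.flip + ((0 : ℤ) : DY J)))
  have e₁ : hbar J * (pm J σ.flip + ((1 : ℤ) : DY J) - pm J σ) =
      hbar J * (pm J σ.flip - pm J σ + 1) := by push_cast; noncomm_ring
  have e₂ : hbar J * (pm J σ + ((1 : ℤ) : DY J) - pm J σ.flip) =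
      hbar J * (pm J σ - pm J σ.flip + 1) := by push_cast; noncomm_ring
  have e₃ : ∀ z : DY J, hbar J * z + hbar J = hbar J * (z + 1) := fun z => by noncomm_ring
  rw [e₁] at l₁
  rw [e₂] at l₂
  rw [e₃, e₃] at r
  have key : lin (hbar J * (pm J σ.flip - pm J σ + ((0 : ℤ) : DY J))) w₁ =
      lin (hbar J * (pm J σ - pm J σ.flip + ((0 : ℤ) : DY J))) w₂ := by
    have b₁ := SuppU.lin (hbar J * (pm J σ.flip - pm J σ + ((0 : ℤ) : DY J))) s₁
    have b₂ := SuppU.lin (hbar J * (pm J σ - pm J σ.flip + ((0 : ℤ) : DY J))) s₂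
    rw [Int.cast_zero, add_zero] at b₁ b₂
    rw [Int.cast_zero, add_zero, add_zero]
    refine eq_of_lin_eqU H (s := pm J σ.flip - pm J σ + 1) _ b₁ b₂ ?_
    refine eq_of_lin_eqU H (s := pm J σ - pm J σ.flip + 1) _ (SuppU.lin _ b₁) (SuppU.lin _ b₂) ?_
    have c : ∀ x y z w : DY J, x = pm J σ - pm J σ.flip ∨ x = pm J σ.flip - pm J σ →
        y = pm J σ - pm J σ.flip ∨ y = pm J σ.flip - pm J σ →
        (z = 0 ∨ z = 1) → (w = 0 ∨ w = 1) → Commute (hbar J * (x + z)) (hbar J * (y + w)) := by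
      intro x y z w hx hy hz hw
      have h1 : ∀ ρ ρ' ρ₂ ρ₃ : Sgn, Commute (pm J ρ - pm J ρ') (pm J ρ₂ - pm J ρ₃) :=
        fun ρ ρ' ρ₂ ρ₃ => ((pm_comm _ _).sub_right (pm_comm _ _)).sub_left
          ((pm_comm _ _).sub_right (pm_comm _ _))
      have hxy : Commute x y := by
        rcases hx with rfl | rfl <;> rcases hy with rfl | rfl <;> exact h1 _ _ _ _
      have hz' : ∀ t, Commute z t := fun t => by
        rcases hz with rfl | rfl
        exacts [Commute.zero_left _, Commute.one_left _]
      have hw' : ∀ t, Commute t w := fun t => by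
        rcases hw with rfl | rfl
        exacts [Commute.zero_right _, Commute.one_right _]
      exact hbar_mul_comm ((hxy.add_right (hw' _)).add_left ((hz' _).add_right (hw' _)))
    have c₀ := c (pm J σ.flip - pm J σ) (pm J σ.flip - pm J σ) 1 0 (.inr rfl) (.inr rfl) (.inr rfl)
      (.inl rfl)
    have c₁ := c (pm J σ.flip - pm J σ) (pm J σ - pm J σ.flip) 1 0 (.inr rfl) (.inl rfl) (.inr rfl)
      (.inl rfl)
    have c₂ := c (pm J σ - pm J σ.flip) (pm J σ.flip - pm J σ) 1 1 (.inl rfl) (.inr rfl) (.inr rfl)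
      (.inr rfl)
    have c₃ := c (pm J σ - pm J σ.flip) (pm J σ - pm J σ.flip) 1 0 (.inl rfl) (.inl rfl) (.inr rfl)
      (.inl rfl)
    rw [add_zero] at c₀ c₁ c₃
    rw [lin_comm c₀, l₁, r, lin_comm c₂, lin_comm c₃, l₂]
  exact ⟨_, p₁, key ▸ p₂⟩

theorem outer_sub_sub (f f' g g' : Dist (DY J)) :
    outer (f - f') (g - g') = outer f g - outer f g' - outer f' g + outer f' g' := by
  ext a b
  simp only [outer, Pi.sub_apply, Pi.add_apply]
  noncomm_ring

theorem outerRev_sub_sub (f f' g g' : Dist (DY J)) :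
    outerRev (f - f') (g - g') =
      outerRev f g - outerRev f g' - outerRev f' g + outerRev f' g' := by
  ext a b
  simp only [outerRev, Pi.sub_apply, Pi.add_apply]
  noncomm_ring

theorem IsRelIdeal.Xcur_Xcur (hJ : IsRelIdeal J) (τ : Sgn) :
    lin (-((τ.val : DY J) * hbar J)) (outer (Xcur J τ) (Xcur J τ)) =
      lin ((τ.val : DY J) * hbar J) (outerRev (Xcur J τ) (Xcur J τ)) := by
  cases τ
  · have e : ((Sgn.val .pos : ℤ) : DY J) * hbar J = hbar J := by simp [Sgn.val]
    rw [e, Xcur_pos, outer_sub_sub, outerRev_sub_sub]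
    simp only [lin_add, lin_sub]
    have r₁ := hJ.curE_curE .pos .pos
    have r₂ := hJ.curE_curE .pos .neg
    have r₃ := hJ.curE_curE .neg .pos
    have r₄ := hJ.curE_curE .neg .neg
    simp only [smul_add] at r₁ r₂ r₃ r₄
    linear_combination (norm := abel) r₁ - r₂ - r₃ + r₄
  · have e : ((Sgn.val .neg : ℤ) : DY J) * hbar J = -hbar J := by simp [Sgn.val]
    rw [e, neg_neg, Xcur_neg, outer_sub_sub, outerRev_sub_sub]
    simp only [lin_add, lin_sub]
    have r₁ := hJ.curF_curF .pos .pos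
    have r₂ := hJ.curF_curF .pos .neg
    have r₃ := hJ.curF_curF .neg .pos
    have r₄ := hJ.curF_curF .neg .neg
    simp only [smul_add] at r₁ r₂ r₃ r₄
    linear_combination (norm := abel) r₁ - r₂ - r₃ + r₄

/-- The commutator of two summands of the currents `X^±`, where `1 / (u - v + ħ (pm ρ.flip - pm ρ))`
is expanded according to a sign `ε` for which all products exist. -/
theorem IsRelIdeal.curE_curF_eq (hJ : IsRelIdeal J) {ε σ τ : Sgn} (hε : τ = ε.flip ∨ σ = ε)
    {U V : BiDist (DY J)}
    (hU : IsProd J (resolvent ε (pm J σ.flip) (pm J σ))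
      (inU (shift J (pm J σ.flip) (ser σ (k2k1inv J σ)))) U)
    (hV : IsProd J (resolvent ε (pm J τ.flip) (pm J τ))
      (inV (shift J (pm J τ) (ser τ (k2k1inv J τ)))) V) :
    outer (curE J σ) (curF J τ) - outerRev (curE J σ) (curF J τ) = hbar J • (V - U) := by
  have H := hJ.isSep
  have r := hJ.curE_curF σ τ
  have hc : Commute (hbar J * (pm J σ.flip - pm J σ)) (hbar J * (pm J τ.flip - pm J τ)) :=
    hbar_mul_comm (((pm_comm _ _).sub_right (pm_comm _ _)).sub_left
      ((pm_comm _ _).sub_right (pm_comm _ _)))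
  rw [← hU.lin_resolvent H (pm_comm _ _), ← hV.lin_resolvent H (pm_comm _ _),
    lin_comm hc.symm U, ← lin_sub, ← lin_sub, ← lin_smul (hbar_comm _).symm,
    ← lin_smul (hbar_comm _).symm] at r
  have hE : ∀ a, 0 < σ.val * a → curE J σ a = 0 := shift_support H _ (ser_support σ _)
  have hF : ∀ a, 0 < τ.val * a → curF J τ a = 0 := shift_support H _ (ser_support τ _)
  rcases hε with rfl | rfl
  · have hU' : SuppV ε.flip U := hU.suppV H (resolvent_suppV H _ _ _) (suppV_inU _ _)
    have hV' : SuppV ε.flip V := hV.suppV H (resolvent_suppV H _ _ _)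
      (suppV_inV (shift_support H _ (ser_support _ _)))
    have b₁ : SuppV ε.flip (outer (curE J σ) (curF J ε.flip) -
        outerRev (curE J σ) (curF J ε.flip)) := fun a b h => by
      rw [Pi.sub_apply, Pi.sub_apply, suppV_outer _ hF a b h, suppV_outerRev _ hF a b h, sub_zero]
    have b₂ : SuppV ε.flip (hbar J • (V - U)) := fun a b h => by
      rw [Pi.smul_apply, Pi.smul_apply, Pi.sub_apply, Pi.sub_apply, hU' a b h, hV' a b h, sub_zero,
        smul_zero]
    exact eq_of_lin_eqV H 0 b₁ b₂ (eq_of_lin_eqV H _ (SuppV.lin _ b₁) (SuppV.lin _ b₂) r)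
  · have hU' : SuppU σ U := hU.suppU H (resolvent_suppU H _ _ _)
      (suppU_inU (shift_support H _ (ser_support _ _)))
    have hV' : SuppU σ V := hV.suppU H (resolvent_suppU H _ _ _) (suppU_inV _ _)
    have b₁ : SuppU σ (outer (curE J σ) (curF J τ) - outerRev (curE J σ) (curF J τ)) :=
      fun a b h => by
        rw [Pi.sub_apply, Pi.sub_apply, suppU_outer _ hE a b h, suppU_outerRev _ hE a b h, sub_zero]
    have b₂ : SuppU σ (hbar J • (V - U)) := fun a b h => by
      rw [Pi.smul_apply, Pi.smul_apply, Pi.sub_apply, Pi.sub_apply, hU' a b h, hV' a b h, sub_zero,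
        smul_zero]
    exact eq_of_lin_eqU H 0 b₁ b₂ (eq_of_lin_eqU H _ (SuppU.lin _ b₁) (SuppU.lin _ b₂) r)

theorem IsRelIdeal.Xcur_commutator (hJ : IsRelIdeal J) : ∃ w₁ w₂ : BiDist (DY J),
    IsProd J (deltaShift J (pm J .neg) (pm J .pos))
      (inU (shift J (pm J .neg) (ser .pos (k2k1inv J .pos)))) w₁ ∧
    IsProd J (deltaShift J (pm J .pos) (pm J .neg))
      (inV (shift J (pm J .neg) (ser .neg (k2k1inv J .neg)))) w₂ ∧
    ∀ a b : ℤ,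
      outer (Xcur J .pos) (Xcur J .neg) a b - outerRev (Xcur J .pos) (Xcur J .neg) a b =
        hbar J * (w₁ a b - w₂ a b) := by
  have H := hJ.isSep
  have exU : ∀ ε σ, ∃ U, IsProd J (resolvent ε (pm J (Sgn.flip σ)) (pm J σ))
      (inU (shift J (pm J (Sgn.flip σ)) (ser σ (k2k1inv J σ)))) U := fun ε σ =>
    (isDeg_resolvent H ε _ _).exists_isProd_inU _
  have exV : ∀ ε τ, ∃ V, IsProd J (resolvent ε (pm J (Sgn.flip τ)) (pm J τ))
      (inV (shift J (pm J τ) (ser τ (k2k1inv J τ)))) V := fun ε τ =>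
    (isDeg_resolvent H ε _ _).exists_isProd_inV _
  choose U hU using exU
  choose V hV using exV
  have r₁ := hJ.curE_curF_eq (ε := .neg) (σ := .pos) (τ := .pos) (.inl rfl) (hU _ _) (hV _ _)
  have r₂ := hJ.curE_curF_eq (ε := .pos) (σ := .pos) (τ := .neg) (.inl rfl) (hU _ _) (hV _ _)
  have r₃ := hJ.curE_curF_eq (ε := .neg) (σ := .neg) (τ := .pos) (.inl rfl) (hU _ _) (hV _ _)
  have r₄ := hJ.curE_curF_eq (ε := .neg) (σ := .neg) (τ := .neg) (.inr rfl) (hU _ _) (hV _ _)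
  refine ⟨U .pos .pos - U .neg .pos, V .pos .neg - V .neg .neg, ?_, ?_, ?_⟩
  · rw [deltaShift_eq H]
    exact (hU .pos .pos).sub_left (hU .neg .pos)
  · rw [deltaShift_eq H]
    exact (hV .pos .neg).sub_left (hV .neg .neg)
  · have : outer (Xcur J .pos) (Xcur J .neg) - outerRev (Xcur J .pos) (Xcur J .neg) =
        hbar J • ((U .pos .pos - U .neg .pos) - (V .pos .neg - V .neg .neg)) := by
      rw [Xcur_pos, Xcur_neg, outer_sub_sub, outerRev_sub_sub]
      simp only [smul_sub] at r₁ r₂ r₃ r₄ ⊢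
      linear_combination (norm := abel) r₁ - r₂ - r₃ + r₄
    exact fun a b => congrFun (congrFun this a) b

end Final

end YangianDouble

end


theorem theorem1 (J : TwoSidedIdeal FreeDY) (hJ : J = relIdeal ∨ J = relIdealTF) :
    -- the series that are inverted are invertible
    (∀ (i : Fin 2) (σ : Sgn), IsUnit (k J i σ)) ∧
    -- `k_i^±(u) k_j^±(v) = k_j^±(v) k_i^±(u)`
    (∀ (i j : Fin 2) (σ : Sgn),
      outer (ser σ (k J i σ)) (ser σ (k J j σ)) =
        outerRev (ser σ (k J i σ)) (ser σ (k J j σ))) ∧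
    -- `k_i^+(u) k_i^-(v) = k_i^-(v) k_i^+(u)`
    (∀ i : Fin 2,
      outer (ser .pos (k J i .pos)) (ser .neg (k J i .neg)) =
        outerRev (ser .pos (k J i .pos)) (ser .neg (k J i .neg))) ∧
    -- `(u_∓ - v_±)/(u_∓ - v_± + ħ) k_2^∓(v)⁻¹ k_1^±(u)
    --    = (u_± - v_∓)/(u_± - v_∓ + ħ) k_1^±(u) k_2^∓(v)⁻¹`
    (∀ σ : Sgn, ∃ w : BiDist (DY J),
      IsProd J (frac J σ (pm J σ.flip) (pm J σ) 0 1)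
        (outerRev (ser σ (k1 J σ)) (ser σ.flip (Ring.inverse (k2 J σ.flip)))) w ∧
      IsProd J (frac J σ (pm J σ) (pm J σ.flip) 0 1)
        (outer (ser σ (k1 J σ)) (ser σ.flip (Ring.inverse (k2 J σ.flip)))) w) ∧
    -- `k_1^±(u)⁻¹ X^+(v) k_1^±(u) = (u_± - v + ħ)/(u_± - v) X^+(v)`
    (∀ σ : Sgn,
      IsProd J (frac J σ (pm J σ) 0 1 0) (inV (Xcur J .pos))
        (sandwich J σ (Ring.inverse (k1 J σ)) (Xcur J .pos) (k1 J σ))) ∧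
    -- `k_1^±(u) X^-(v) k_1^±(u)⁻¹ = (u_∓ - v + ħ)/(u_∓ - v) X^-(v)`
    (∀ σ : Sgn,
      IsProd J (frac J σ (pm J σ.flip) 0 1 0) (inV (Xcur J .neg))
        (sandwich J σ (k1 J σ) (Xcur J .neg) (Ring.inverse (k1 J σ)))) ∧
    -- `k_2^±(u)⁻¹ X^+(v) k_2^±(u) = (u_± - v - ħ)/(u_± - v) X^+(v)`
    (∀ σ : Sgn,
      IsProd J (frac J σ (pm J σ) 0 (-1) 0) (inV (Xcur J .pos))
        (sandwich J σ (Ring.inverse (k2 J σ)) (Xcur J .pos) (k2 J σ))) ∧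
    -- `k_2^±(u) X^-(v) k_2^±(u)⁻¹ = (u_∓ - v - ħ)/(u_∓ - v) X^-(v)`
    (∀ σ : Sgn,
      IsProd J (frac J σ (pm J σ.flip) 0 (-1) 0) (inV (Xcur J .neg))
        (sandwich J σ (k2 J σ) (Xcur J .neg) (Ring.inverse (k2 J σ)))) ∧
    -- `(u - v ∓ ħ) X^±(u) X^±(v) = (u - v ± ħ) X^±(v) X^±(u)`
    (∀ τ : Sgn,
      lin (-((τ.val : DY J) * hbar J)) (outer (Xcur J τ) (Xcur J τ)) =
        lin ((τ.val : DY J) * hbar J) (outerRev (Xcur J τ) (Xcur J τ))) ∧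
    -- `[X^+(u), X^-(v)] = ħ {δ(u_- - v_+) k_2^+(u_-) k_1^+(u_-)⁻¹
    --    - δ(u_+ - v_-) k_2^-(v_-) k_1^-(v_-)⁻¹}`
    (∃ w₁ w₂ : BiDist (DY J),
      IsProd J (deltaShift J (pm J .neg) (pm J .pos))
        (inU (shift J (pm J .neg) (ser .pos (k2k1inv J .pos)))) w₁ ∧
      IsProd J (deltaShift J (pm J .pos) (pm J .neg))
        (inV (shift J (pm J .neg) (ser .neg (k2k1inv J .neg)))) w₂ ∧
      ∀ a b : ℤ,
        outer (Xcur J .pos) (Xcur J .neg) a b - outerRev (Xcur J .pos) (Xcur J .neg) a b =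
          hbar J * (w₁ a b - w₂ a b)) := by
  have h : IsRelIdeal J := by
    rcases hJ with rfl | rfl
    exacts [isRelIdeal_relIdeal, isRelIdeal_relIdealTF]
  refine ⟨isUnit_k, h.k_comm, fun i => h.k_comm_mixed i .pos .neg, h.k1_k2inv_mixed,
    fun σ => isProd_frac_sub h.isSep (X := curE J .pos) (Y := curE J .neg)
      (Z := -(hbar J • inU (ser σ (e J σ)))) ?_ ?_,
    fun σ => isProd_frac_sub h.isSep (X := curF J .pos) (Y := curF J .neg)
      (Z := -(hbar J • inU (ser σ (f J σ)))) ?_ ?_,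
    fun σ => isProd_frac_sub h.isSep (X := curE J .pos) (Y := curE J .neg)
      (Z := hbar J • inU (ser σ (e J σ))) ?_ ?_,
    fun σ => isProd_frac_sub h.isSep (X := curF J .pos) (Y := curF J .neg)
      (Z := hbar J • inU (ser σ (f J σ))) ?_ ?_,
    h.Xcur_Xcur, h.Xcur_commutator⟩
  · simpa [sub_eq_add_neg] using h.k1_curE σ .pos
  · simpa [sub_eq_add_neg] using h.k1_curE σ .neg
  · simpa [sub_eq_add_neg] using h.k1_curF σ .pos
  · simpa [sub_eq_add_neg] using h.k1_curF σ .neg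
  · simpa using h.k2_curE σ .pos
  · simpa using h.k2_curE σ .neg
  · simpa using h.k2_curF σ .pos
  · simpa using h.k2_curF σ .neg
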